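/- **Setting.** For complex sequences $u,v\in\mathbb C^{\mathbb Z}$ let $[u*v]_t=\sum_\tau u_\tau v_{t-\tau}$, $[\Delta u]_t=u_{t-1}$, $\|u\|_{n,2}=\big(\sum_{t=0}^n|u_t|^2\big)^{1/2}$ and $$\|u\|^*_{m,1}=\sum_{k=0}^m\Big|\frac1{\sqrt{m+1}}\sum_{t=0}^m u_t e^{2\pi i kt/(m+1)}\Big| .$$ Let $m,n\ge 1$ be integers. One observes $y_t=x_t+\sigma\zeta_t$, where $\sigma\ge 0$ and the $\zeta_t$ are i.i.d. standard complex Gaussian ($\zeta_t=\xi^1_t+i\xi^2_t$ with $\xi^1_t,\xi_t^2$ independent $\mathcal N(0,1)$). Assume that $x=x^{\mathcal S}+\varepsilon$ with $x^{\mathcal S}\in\mathcal S$, where $\mathcal S\subset\mathbb C^{\mathbb Z}$ is an (unknown) linear subspace with $\Delta\mathcal S\subseteq\mathcal S$ of dimension $s$, $1\le s\le n+1$, and that, for some $\varkappa\ge0$, $\|\Delta^\tau\varepsilon\|_{n,2}\le\varkappa\sigma$ for all $0\le\tau\le m$. For $\lambda>0$ the penalized least-squares filter $\widehat\varphi$ is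 any minimizer, over the filters $\varphi$ supported on $\{0,\dots,m\}$, of $$\|y-\varphi*y\|_{n,2}^2+\lambda^2\sigma^2\big(\sqrt{m+1}\,\|\varphi\|^*_{m,1}\big)^2 .$$ For $\alpha\in(0,1]$ put $\kappa=\sqrt{(n+1)/(m+1)}$, $c_\alpha=\sqrt{2\ln(16/\alpha)}$, $V_\alpha=2(1+4\kappa)^2\ln\big(55(m+n+1)/\alpha\big)$, $W_\alpha=(1+\kappa)^2(1+c_\alpha)^2$, $\ell_\alpha=\max\{\ln(1/\alpha),\ln 2\}$ and $$r_1=\max\{1,\kappa^2\}\ln\frac{m+n}{\alpha}+\varkappa\sqrt{\ell_\alpha}+1,\qquad r_2=\varrho\ln\frac1\alpha+\varkappa\sqrt{\ell_\alpha}+s .$$ **Theorem.** There are absolute constants $C,C',C''>0$ such that the following holds in this setting for every $\varrho\ge1$, every (deterministic) filter $\varphi$ supported on $\{0,\dots,m\}$ with $\|\varphi\|^*_{m,1}\le\varrho/\sqrt{m+1}$, and every $\alpha\in(0,1]$. There is a set $\Xi_\alpha$ of realizations of the noise with $\mathbb P\{\zeta\in\Xi_\alpha\}\ge1-\alpha$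 such that, whenever $\zeta\in\Xi_\alpha$, every penalized least-squares filter $\widehat\varphi$ satisfies 1. $$\|x-\widehat\varphi*y\|_{n,2}\le\|x-\varphi*y\|_{n,2}+\sigma\big(\lambda\varrho+4\lambda^{-1}(c_\alpha\varkappa+V_\alpha)\big)+2\sigma\Big[\sqrt{\varrho W_\alpha}+\sqrt{c_\alpha\varkappa}+\sqrt{2s}+c_\alpha\Big];$$ 2. $$\|x-\widehat\varphi*y\|_{n,2}\le\|x-\varphi*y\|_{n,2}+\sigma\big[\lambda\varrho+C\lambda^{-1}r_1+C'r_2^{1/2}\big];$$ 3. in particular, if $\lambda=r_1^{1/2}$, then $$\|x-\widehat\varphi*y\|_{n,2}\le\|x-\varphi*y\|_{n,2}+\sigma\big[C''\varrho\, r_1^{1/2}+C'r_2^{1/2}\big].$$ -/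

import Mathlib

open MeasureTheory ProbabilityTheory

namespace SignalRecovery

noncomputable section

/-- The right shift on two-sided complex sequences: `[Δ x]_t = x_{t-1}`. -/
def shift (x : ℤ → ℂ) : ℤ → ℂ := fun t => x (t - 1)

/-- The space of sequences supported on `{0, …, m}` (the filters of bandwidth `m`). -/
def filters (m : ℕ) : Submodule ℂ (ℤ → ℂ) where
  carrier := {φ | ∀ t : ℤ, t ∉ Set.Icc (0 : ℤ) (m : ℤ) → φ t = 0}
  add_mem' := fun {a b} ha hb t ht => by simp [ha t ht, hb t ht]
  zero_mem' := fun t _ => rfl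
  smul_mem' := fun c a ha t ht => by simp [ha t ht]

/-- The convolution `[u * v]_t = ∑_τ u_τ v_{t-τ}`. -/
def conv (u v : ℤ → ℂ) : ℤ → ℂ := fun t => ∑' τ : ℤ, u τ * v (t - τ)

/-- The Euclidean norm `‖x‖_{n,2}` of the window `(x_0, …, x_n)`. -/
def windowNorm (n : ℕ) (x : ℤ → ℂ) : ℝ :=
  √(∑ t ∈ Finset.range (n + 1), ‖x (t : ℤ)‖ ^ 2)

/-- The `k`-th coordinate of the unitary discrete Fourier transform of `(x_0, …, x_n)`. -/
def dft (n : ℕ) (x : ℤ → ℂ) (k : ℕ) : ℂ :=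
  ((√((n : ℝ) + 1))⁻¹ : ℝ) *
    ∑ t ∈ Finset.range (n + 1),
      x (t : ℤ) * Complex.exp (2 * Real.pi * Complex.I * k * t / (n + 1))

/-- The norm `‖x‖*_{n,1}`: the `ℓ₁`-norm of the discrete Fourier transform of `(x_0, …, x_n)`. -/
def fourierL1 (n : ℕ) (x : ℤ → ℂ) : ℝ :=
  ∑ k ∈ Finset.range (n + 1), ‖dft n x k‖

/-- The objective of the penalized least-squares problem,
`‖y - φ * y‖²_{n,2} + λ² σ² (√(m+1) ‖φ‖*_{m,1})²`. -/
def penalizedObjective (m n : ℕ) (lam σ : ℝ) (y φ : ℤ → ℂ) : ℝ :=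
  windowNorm n (y - conv φ y) ^ 2
    + lam ^ 2 * σ ^ 2 * (√((m : ℝ) + 1) * fourierL1 m φ) ^ 2

/-- `φ` is an optimal solution of the penalized least-squares problem over all filters of
bandwidth `m`, for the data `y`. -/
def IsPenalizedSolution (m n : ℕ) (lam σ : ℝ) (y φ : ℤ → ℂ) : Prop :=
  φ ∈ filters m ∧ ∀ ψ ∈ filters m,
    penalizedObjective m n lam σ y φ ≤ penalizedObjective m n lam σ y ψ

/-- The signal `x` decomposes as `x = xS + ε`, with `xS` in a shift-invariant subspace of
dimension `s`, `1 ≤ s ≤ n + 1`, and `‖Δ^τ ε‖_{n,2} ≤ ϰ σ` for `0 ≤ τ ≤ m`. -/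
def NearShiftInvariant (m n s : ℕ) (ϰ σ : ℝ) (x : ℤ → ℂ) : Prop :=
  1 ≤ s ∧ s ≤ n + 1 ∧
    ∃ S : Submodule ℂ (ℤ → ℂ), (∀ u ∈ S, shift u ∈ S) ∧ Module.finrank ℂ S = s ∧
      ∃ xS ∈ S, ∃ ε : ℤ → ℂ, x = xS + ε ∧
        ∀ τ : ℕ, τ ≤ m → windowNorm n (shift^[τ] ε) ≤ ϰ * σ

/-- The standard complex Gaussian law: the law of `ξ¹ + i ξ²` with `ξ¹, ξ²` independent and
standard normal. -/
def stdComplexGaussian : Measure ℂ :=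
  ((gaussianReal 0 1).prod (gaussianReal 0 1)).map (fun p : ℝ × ℝ => (p.1 : ℂ) + p.2 * Complex.I)

/-- `κ_{m,n} = √((n+1)/(m+1))`. -/
def kappa (m n : ℕ) : ℝ := √(((n : ℝ) + 1) / ((m : ℝ) + 1))

/-- `c_α = √(2 ln(16/α))`. -/
def cAlpha (α : ℝ) : ℝ := √(2 * Real.log (16 / α))

/-- `V_α = 2 (1 + 4 κ_{m,n})² ln(55 (m+n+1)/α)`. -/
def vAlpha (m n : ℕ) (α : ℝ) : ℝ :=
  2 * (1 + 4 * kappa m n) ^ 2 * Real.log (55 * ((m : ℝ) + n + 1) / α)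

/-- `W_α = (1 + κ_{m,n})² (1 + c_α)²`. -/
def wAlpha (m n : ℕ) (α : ℝ) : ℝ := (1 + kappa m n) ^ 2 * (1 + cAlpha α) ^ 2

/-- `r₁ = max(1, κ²_{m,n}) ln((m+n)/α) + ϰ √(max(ln(1/α), ln 2)) + 1`. For `m ≤ n` and
`α ≤ 1/2` this is `κ²_{m,n} ln((m+n)/α) + ϰ √(ln(1/α)) + 1`. -/
def r1 (m n : ℕ) (ϰ α : ℝ) : ℝ :=
  max 1 (kappa m n ^ 2) * Real.log (((m : ℝ) + n) / α)
    + ϰ * √(max (Real.log (1 / α)) (Real.log 2)) + 1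

/-- `r₂ = ϱ ln(1/α) + ϰ √(max(ln(1/α), ln 2)) + s`. For `α ≤ 1/2` this is
`ϱ ln(1/α) + ϰ √(ln(1/α)) + s`. -/
def r2 (ϱ : ℝ) (s : ℕ) (ϰ α : ℝ) : ℝ :=
  ϱ * Real.log (1 / α) + ϰ * √(max (Real.log (1 / α)) (Real.log 2)) + s

end

end SignalRecovery

namespace SignalRecovery

open scoped RealInnerProductSpace

/-! ### Chi-square-type bounds for quadratic forms in a standard Gaussian vector -/

/-! Write `a` and `X` for the windows of `x - φ * y` and `x - φhat * y`. Optimality of `φhat` and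
expansion of the squares give `‖X‖² ≤ ‖a‖² + 2σ Re⟨a - X, ζ⟩` plus the difference of the penalties,
where `a - X` is the window of `(φhat - φ) * y`. The noise window is split along `K`, the window
image of the shift-invariant subspace. On `K` the noise has norm at most `√(2s) + c_α`. On `Kᗮ` the
part of `y` in the subspace disappears, because shift invariance keeps its filtered version inside
the subspace. What remains is the correlation with the filtered `ε`, handled by Cauchy-Schwarz, and
with the filtered noise. For the latter the filter is expanded in the Fourier basis, so the
correlation is at most `‖φ‖*` times a maximum of `m + 1` quadratic forms of the noise. Both
contributions are linear in `√(m+1) ‖φ‖*`, so completing the square absorbs the unknown norm of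
`φhat` into the penalty (`le_add_of_sq_le_penalized`). The quadratic forms are diagonalized by
embedding the filters cyclically on `m + n + 1` points (`fourierOutput_eq`). The `ℓ₁` bound on the
Dirichlet kernel controls their weights, and a Chernoff bound depending only on the trace and on an
operator norm at most one (`stdGaussian_sum_norm_sq_tail`) controls the tails. The resulting
inequality contains neither `√(ϱ W_α)` nor `√(c_α ϰ)`, so it is stronger than the first claim. -/

theorem integrable_exp_mul_sq_gaussianReal {u : ℝ} (hu : u < 1 / 2) :
    Integrable (fun x : ℝ => Real.exp (u * x ^ 2)) (gaussianReal 0 1) := by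
  rw [gaussianReal_of_var_ne_zero 0 one_ne_zero, gaussianPDF_def,
    integrable_withDensity_iff_integrable_smul₀' (by fun_prop) (by simp)]
  have h := (integrable_exp_neg_mul_sq (b := 1 / 2 - u) (by linarith)).const_mul
    (√(2 * Real.pi))⁻¹
  refine h.congr (Filter.Eventually.of_forall fun x => ?_)
  simp only [gaussianPDFReal, smul_eq_mul, sub_zero, NNReal.coe_one, mul_one]
  rw [ENNReal.toReal_ofReal (by positivity), mul_assoc, ← Real.exp_add]
  congr 2; ring

theorem integral_exp_mul_sq_gaussianReal {u : ℝ} (hu : u < 1 / 2) :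
    ∫ x : ℝ, Real.exp (u * x ^ 2) ∂(gaussianReal 0 1) = (1 - 2 * u) ^ (-(1 / 2) : ℝ) := by
  rw [integral_gaussianReal_eq_integral_smul one_ne_zero]
  have h : ∀ x : ℝ, gaussianPDFReal 0 1 x • Real.exp (u * x ^ 2)
      = (√(2 * Real.pi))⁻¹ * Real.exp (-(1 / 2 - u) * x ^ 2) := by
    intro x
    simp only [gaussianPDFReal, smul_eq_mul, sub_zero, NNReal.coe_one, mul_one]
    rw [mul_assoc, ← Real.exp_add]
    congr 2; ring
  simp_rw [h]
  rw [integral_const_mul, integral_gaussian, Real.rpow_neg (by linarith), ← Real.sqrt_eq_rpow,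
    ← Real.sqrt_inv, ← Real.sqrt_inv, ← Real.sqrt_mul (by positivity)]
  congr 1
  have : (1 - 2 * u) ≠ 0 := by linarith
  have : (1 / 2 - u) ≠ 0 := by linarith
  field_simp

section QuadraticForm

variable {E : Type*} [NormedAddCommGroup E] [InnerProductSpace ℝ E] [FiniteDimensional ℝ E]

/-- A sum of squares of linear forms is diagonal in some orthonormal basis. -/
theorem exists_diagonalization_sum_sq {J : Type*} [Fintype J] (f : J → E)
    (hf : ∀ x, ∑ j, ⟪f j, x⟫ ^ 2 ≤ ‖x‖ ^ 2) :
    ∃ (b : OrthonormalBasis (Fin (Module.finrank ℝ E)) ℝ E)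
      (w : Fin (Module.finrank ℝ E) → ℝ),
      (∀ i, 0 ≤ w i) ∧ (∀ i, w i ≤ 1) ∧ ∑ i, w i = ∑ j, ‖f j‖ ^ 2 ∧
      ∀ g : Fin (Module.finrank ℝ E) → ℝ,
        ∑ j, ⟪f j, ∑ i, g i • b i⟫ ^ 2 = ∑ i, w i * g i ^ 2 := by
  -- The weights are the eigenvalues of `∑ f_j ⊗ f_j`: `hf` puts them in `[0, 1]`, and Parseval
  -- identifies their sum, the trace, with `∑ ‖f_j‖²`.
  let T : E →ₗ[ℝ] E := ∑ j, (innerₛₗ ℝ (f j)).smulRight (f j)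
  have hT : ∀ x y, ⟪x, T y⟫ = ∑ j, ⟪f j, x⟫ * ⟪f j, y⟫ := by
    intro x y
    simp only [T, LinearMap.sum_apply, LinearMap.smulRight_apply, innerₛₗ_apply_apply, inner_sum,
      inner_smul_right]
    exact Finset.sum_congr rfl fun j _ => by rw [real_inner_comm x, mul_comm]
  have hsym : T.IsSymmetric := by
    intro x y
    rw [real_inner_comm, hT, hT]
    exact Finset.sum_congr rfl fun j _ => mul_comm _ _
  let b := hsym.eigenvectorBasis rfl
  have hbT : ∀ i k, ⟪b i, T (b k)⟫ = if i = k then hsym.eigenvalues rfl k else 0 := by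
    intro i k
    rw [hsym.apply_eigenvectorBasis rfl k]
    simp only [RCLike.ofReal_real_eq_id, id_eq, inner_smul_right]
    rw [orthonormal_iff_ite.1 (hsym.eigenvectorBasis rfl).orthonormal i k]
    split_ifs <;> simp
  have hw : ∀ i, hsym.eigenvalues rfl i = ∑ j, ⟪f j, b i⟫ ^ 2 := by
    intro i
    have := hbT i i
    rw [hT, if_pos rfl] at this
    rw [← this]
    exact Finset.sum_congr rfl fun j _ => by ring
  refine ⟨b, hsym.eigenvalues rfl, fun i => ?_, fun i => ?_, ?_, fun g => ?_⟩
  · rw [hw]; positivity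
  · rw [hw]
    refine (hf _).trans ?_
    rw [b.norm_eq_one]; norm_num
  · simp_rw [hw]
    rw [Finset.sum_comm]
    refine Finset.sum_congr rfl fun j _ => ?_
    rw [← b.sum_sq_norm_inner_right (f j)]
    exact Finset.sum_congr rfl fun i _ => by rw [real_inner_comm, Real.norm_eq_abs, sq_abs]
  · have h1 : ∑ j, ⟪f j, ∑ i, g i • b i⟫ ^ 2 = ⟪∑ i, g i • b i, T (∑ i, g i • b i)⟫ := by
      rw [hT]
      exact Finset.sum_congr rfl fun j _ => by ring
    rw [h1, map_sum, inner_sum]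
    refine Finset.sum_congr rfl fun k _ => ?_
    rw [sum_inner, map_smul]
    simp only [inner_smul_left, inner_smul_right, hbT]
    simp
    ring

variable [MeasurableSpace E] [BorelSpace E]

/-- Rotation invariance of the Gaussian reduces the form to independent weighted squares, so the
moment generating function is a product of one-dimensional ones. -/
theorem mgf_sum_sq_stdGaussian {J : Type*} [Fintype J] (f : J → E)
    (hf : ∀ x, ∑ j, ⟪f j, x⟫ ^ 2 ≤ ‖x‖ ^ 2) {θ : ℝ} (hθ : 0 ≤ θ) (hθ' : θ < 1 / 2) :
    Integrable (fun x => Real.exp (θ * ∑ j, ⟪f j, x⟫ ^ 2)) (stdGaussian E) ∧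
    mgf (fun x => ∑ j, ⟪f j, x⟫ ^ 2) (stdGaussian E) θ
      ≤ (1 - 2 * θ) ^ (-((∑ j, ‖f j‖ ^ 2) / 2)) := by
  obtain ⟨b, w, hw0, hw1, hws, hd⟩ := exists_diagonalization_sum_sq f hf
  have hu : ∀ i, θ * w i < 1 / 2 := fun i =>
    (mul_le_of_le_one_right hθ (hw1 i)).trans_lt hθ'
  have hexp : (fun g : Fin (Module.finrank ℝ E) → ℝ =>
      Real.exp (θ * ∑ j, ⟪f j, ∑ i, g i • b i⟫ ^ 2))
      = fun g => ∏ i, Real.exp (θ * w i * g i ^ 2) := by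
    ext g
    rw [hd, ← Real.exp_sum, Finset.mul_sum]
    congr 1
    exact Finset.sum_congr rfl fun i _ => by ring
  have hmeas : Measurable fun g : Fin (Module.finrank ℝ E) → ℝ => ∑ i, g i • b i := by fun_prop
  have hc : Continuous fun x : E => Real.exp (θ * ∑ j, ⟪f j, x⟫ ^ 2) := by fun_prop
  rw [mgf, stdGaussian_eq_map_pi_orthonormalBasis b,
    integrable_map_measure hc.aestronglyMeasurable hmeas.aemeasurable,
    integral_map hmeas.aemeasurable hc.aestronglyMeasurable]
  simp only [Function.comp_def]
  rw [hexp]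
  refine ⟨Integrable.fintype_prod fun i => integrable_exp_mul_sq_gaussianReal (hu i), ?_⟩
  rw [integral_fintype_prod_eq_prod
    (f := fun i x => Real.exp (θ * w i * x ^ 2))]
  simp_rw [fun i => integral_exp_mul_sq_gaussianReal (hu i)]
  have hpos : 0 < 1 - 2 * θ := by linarith
  rw [← hws, Finset.sum_div, ← Finset.sum_neg_distrib, Real.rpow_sum_of_pos hpos]
  refine Finset.prod_le_prod (fun i _ => ?_) fun i _ => ?_
  · exact Real.rpow_nonneg (by linarith [hu i]) _
  -- Bernoulli for exponents in `[0, 1]`: `(1 - 2θ)^w ≤ 1 - 2θw`. Each factor is thus at most `(1 -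
  -- 2θ)^(-w/2)`, and only the sum of the weights survives in the product.
  · have h := rpow_one_add_le_one_add_mul_self (s := -(2 * θ)) (by linarith) (hw0 i) (hw1 i)
    have h2 := Real.rpow_le_rpow_of_nonpos (z := -(1 / 2)) (Real.rpow_pos_of_pos
      (by linarith) (w i)) h (by norm_num)
    calc _ = (1 + w i * -(2 * θ)) ^ (-(1 / 2) : ℝ) := by congr 1; ring
      _ ≤ _ := h2
      _ = _ := by
        rw [← Real.rpow_mul (by linarith)]
        congr 1; ring

/-- Chernoff bound for a sum of squares of linear forms in a standard Gaussian vector. -/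
theorem stdGaussian_sum_sq_tail {J : Type*} [Fintype J] (f : J → E)
    (hf : ∀ x, ∑ j, ⟪f j, x⟫ ^ 2 ≤ ‖x‖ ^ 2) {θ : ℝ} (hθ : 0 ≤ θ) (hθ' : θ < 1 / 2)
    {a : ℝ} (ha : ∑ j, ‖f j‖ ^ 2 ≤ a) (t : ℝ) :
    (stdGaussian E).real {x | t ≤ ∑ j, ⟪f j, x⟫ ^ 2}
      ≤ Real.exp (-θ * t) * (1 - 2 * θ) ^ (-(a / 2)) := by
  obtain ⟨h1, h2⟩ := mgf_sum_sq_stdGaussian f hf hθ hθ'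
  refine (measure_ge_le_exp_mul_mgf t hθ h1).trans ?_
  gcongr
  exact h2.trans (Real.rpow_le_rpow_of_exponent_ge (by linarith) (by linarith) (by linarith))

end QuadraticForm

/-! ### Complex Gaussian vectors -/

theorem charFun_stdComplexGaussian (t : ℂ) :
    charFun stdComplexGaussian t = Complex.exp (-‖t‖ ^ 2 / 2) := by
  rw [charFun_apply, stdComplexGaussian, integral_map (by fun_prop) (by fun_prop)]
  have h : ∀ p : ℝ × ℝ, Complex.exp ((⟪(p.1 : ℂ) + p.2 * Complex.I, t⟫ : ℝ) * Complex.I)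
      = Complex.exp (t.re * p.1 * Complex.I) * Complex.exp (t.im * p.2 * Complex.I) := by
    intro p
    rw [← Complex.exp_add]
    congr 1
    have : ⟪(p.1 : ℂ) + p.2 * Complex.I, t⟫ = t.re * p.1 + t.im * p.2 := by
      rw [Complex.inner]; simp
    rw [this]; push_cast; ring
  simp_rw [h]
  rw [integral_prod_mul (fun x : ℝ => Complex.exp (t.re * x * Complex.I))
    (fun x : ℝ => Complex.exp (t.im * x * Complex.I)),
    ← charFun_apply_real, ← charFun_apply_real, charFun_gaussianReal, charFun_gaussianReal,
    ← Complex.exp_add]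
  congr 1
  rw [← Complex.ofReal_pow ‖t‖, ← Complex.normSq_eq_norm_sq, Complex.normSq_apply]
  push_cast; simp; ring

instance : IsProbabilityMeasure stdComplexGaussian :=
  Measure.isProbabilityMeasure_map (by fun_prop)

theorem hasLaw_stdGaussian_of_iIndepFun {Ω ι : Type*} [MeasurableSpace Ω] [Fintype ι]
    {P : Measure Ω} {ζ : ι → Ω → ℂ}
    (hζ : ∀ i, HasLaw (ζ i) stdComplexGaussian P) (hind : iIndepFun ζ P) :
    HasLaw (fun ω => WithLp.toLp 2 fun i => ζ i ω) (stdGaussian (EuclideanSpace ℂ ι)) P := by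
  have h1 := hind.hasLaw_pi hζ
  have h2 : HasLaw (WithLp.toLp 2 : (ι → ℂ) → EuclideanSpace ℂ ι)
      (stdGaussian (EuclideanSpace ℂ ι)) (Measure.pi fun _ => stdComplexGaussian) := by
    refine ⟨by fun_prop, ?_⟩
    have : IsFiniteMeasure ((Measure.pi fun _ : ι => stdComplexGaussian).map (WithLp.toLp 2)) :=
      Measure.isFiniteMeasure_map _ _
    refine Measure.ext_of_charFun ?_
    ext t
    rw [charFun_pi, charFun_stdGaussian]
    simp_rw [charFun_stdComplexGaussian]
    rw [← Complex.exp_sum, ← Finset.sum_div, Finset.sum_neg_distrib]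
    congr 3
    rw [← Complex.ofReal_pow, PiLp.norm_sq_eq_of_L2]
    push_cast; rfl
  exact h2.fun_comp h1

theorem norm_inner_sq_eq_add {ι : Type*} [Fintype ι] (f x : EuclideanSpace ℂ ι) :
    ‖inner ℂ f x‖ ^ 2 = ⟪f, x⟫ ^ 2 + ⟪Complex.I • f, x⟫ ^ 2 := by
  have h : ∀ g : EuclideanSpace ℂ ι, ⟪g, x⟫ = (inner ℂ g x).re := by
    intro g
    simp [PiLp.inner_apply, Complex.inner]
  rw [h, h, inner_smul_left, ← Complex.normSq_eq_norm_sq, Complex.normSq_apply]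
  simp; ring

/-- Chernoff bound for a Hermitian sum of squares in a standard complex Gaussian vector. -/
theorem stdGaussian_sum_norm_sq_tail {ι J : Type*} [Fintype ι] [Fintype J]
    (f : J → EuclideanSpace ℂ ι) (hf : ∀ x, ∑ j, ‖inner ℂ (f j) x‖ ^ 2 ≤ ‖x‖ ^ 2)
    {θ : ℝ} (hθ : 0 ≤ θ) (hθ' : θ < 1 / 2) {a : ℝ} (ha : ∑ j, ‖f j‖ ^ 2 ≤ a) (t : ℝ) :
    (stdGaussian (EuclideanSpace ℂ ι)).real {x | t ≤ ∑ j, ‖inner ℂ (f j) x‖ ^ 2}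
      ≤ Real.exp (-θ * t) * (1 - 2 * θ) ^ (-a) := by
  -- A complex form is a pair of real forms of equal norm, which doubles the trace and turns the
  -- exponent `-a/2` into `-a`.
  have key : ∀ x, ∑ j : J ⊕ J, ⟪Sum.elim f (fun j => Complex.I • f j) j, x⟫ ^ 2
      = ∑ j, ‖inner ℂ (f j) x‖ ^ 2 := by
    intro x
    simp only [norm_inner_sq_eq_add, Fintype.sum_sum_type, Sum.elim_inl, Sum.elim_inr,
      Finset.sum_add_distrib]
  have h := stdGaussian_sum_sq_tail (Sum.elim f fun j => Complex.I • f j)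
    (fun x => (key x).trans_le (hf x)) hθ hθ' (a := 2 * a) ?_ t
  · simp_rw [key] at h
    convert h using 3
    ring
  · simp only [Fintype.sum_sum_type, Sum.elim_inl, Sum.elim_inr, norm_smul, Complex.norm_I, one_mul]
    linarith

/-! ### The Dirichlet kernel -/

/-- The Dirichlet kernel `∑_{τ < M} e^{2π i τ x}`. -/
noncomputable def dirichlet (M : ℕ) (x : ℝ) : ℂ :=
  ∑ τ ∈ Finset.range M, Complex.exp (2 * Real.pi * Complex.I * τ * x)

theorem norm_dirichlet_le (M : ℕ) (x : ℝ) : ‖dirichlet M x‖ ≤ M := by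
  refine (norm_sum_le _ _).trans ?_
  have h : ∀ τ : ℕ, ‖Complex.exp (2 * Real.pi * Complex.I * τ * x)‖ = 1 := by
    intro τ
    rw [← Complex.norm_exp_ofReal_mul_I (2 * Real.pi * τ * x)]
    congr 2; push_cast; ring
  simp [h]

theorem dirichlet_add_one (M : ℕ) (x : ℝ) : dirichlet M (x + 1) = dirichlet M x := by
  refine Finset.sum_congr rfl fun τ _ => ?_
  rw [Complex.exp_eq_exp_iff_exists_int]
  exact ⟨τ, by push_cast; ring⟩

/-- The geometric sum is at most `2 / |e^{2πix} - 1| = 1 / sin(πx)`; Jordan's inequality is then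
applied at whichever of `0` and `1` is nearer. -/
theorem norm_dirichlet_le_of_mem_Ioo (M : ℕ) {x : ℝ} (h0 : 0 < x) (h1 : x < 1) :
    ‖dirichlet M x‖ ≤ (2 * x)⁻¹ + (2 * (1 - x))⁻¹ := by
  set ω := Complex.exp (Complex.I * (2 * Real.pi * x : ℝ)) with hω
  have hsum : dirichlet M x = ∑ τ ∈ Finset.range M, ω ^ τ := by
    refine Finset.sum_congr rfl fun τ _ => ?_
    rw [hω, ← Complex.exp_nat_mul]
    congr 1; push_cast; ring
  have hnorm : ‖ω‖ = 1 := by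
    rw [hω, mul_comm, Complex.norm_exp_ofReal_mul_I]
  have hgeom : ‖dirichlet M x‖ * ‖ω - 1‖ ≤ 2 := by
    rw [← norm_mul, hsum, geom_sum_mul]
    refine (norm_sub_le _ _).trans ?_
    rw [norm_pow, hnorm]; norm_num
  have hsin : ‖ω - 1‖ = 2 * Real.sin (Real.pi * x) := by
    rw [hω, Complex.norm_exp_I_mul_ofReal_sub_one, Real.norm_eq_abs, abs_of_nonneg]
    · congr 2; ring
    · have := Real.sin_nonneg_of_nonneg_of_le_pi (x := 2 * Real.pi * x / 2)
        (by positivity) (by nlinarith [Real.pi_pos])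
      linarith
  have hx' : 0 < 1 - x := by linarith
  rcases le_total x (1 / 2) with hx | hx
  · have hs := Real.mul_le_sin (x := Real.pi * x) (by positivity) (by nlinarith [Real.pi_pos])
    have : 2 / Real.pi * (Real.pi * x) = 2 * x := by field_simp
    have h4 : ‖dirichlet M x‖ * (2 * (2 * x)) ≤ 2 :=
      le_trans (by gcongr; rw [hsin]; linarith) hgeom
    have : ‖dirichlet M x‖ ≤ (2 * x)⁻¹ := by
      rw [← one_div, le_div_iff₀ (by positivity)]; linarith
    linarith [inv_pos.2 (show 0 < 2 * (1 - x) by linarith)]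
  · have hs := Real.mul_le_sin (x := Real.pi * (1 - x)) (by positivity)
      (by nlinarith [Real.pi_pos])
    have : 2 / Real.pi * (Real.pi * (1 - x)) = 2 * (1 - x) := by field_simp
    rw [show Real.pi * (1 - x) = Real.pi - Real.pi * x by ring, Real.sin_pi_sub] at hs
    rw [show Real.pi - Real.pi * x = Real.pi * (1 - x) by ring] at hs
    have h4 : ‖dirichlet M x‖ * (2 * (2 * (1 - x))) ≤ 2 :=
      le_trans (by gcongr; rw [hsin]; linarith) hgeom
    have : ‖dirichlet M x‖ ≤ (2 * (1 - x))⁻¹ := by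
      rw [← one_div, le_div_iff₀ (by positivity)]; linarith
    linarith [inv_pos.2 (show 0 < 2 * x by linarith)]

theorem sum_range_add_of_periodic {N : ℕ} {F : ℤ → ℝ} (hF : ∀ i, F (i + N) = F i) (p : ℤ) :
    ∑ j ∈ Finset.range N, F (p + j) = ∑ j ∈ Finset.range N, F j := by
  have step : ∀ p : ℤ, ∑ j ∈ Finset.range N, F (p + 1 + j) = ∑ j ∈ Finset.range N, F (p + j) := by
    intro p
    have h1 := Finset.sum_range_succ (fun j : ℕ => F (p + j)) N
    rw [Finset.sum_range_succ', hF] at h1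
    simp only [Nat.cast_zero, add_zero, add_left_inj] at h1
    rw [← h1]
    refine Finset.sum_congr rfl fun j _ => ?_
    congr 1; push_cast; ring
  induction p using Int.induction_on with
  | zero => simp
  | succ i ih => rw [step, ih]
  | pred i ih => rw [← ih, ← step]; simp

theorem sum_range_inv_le (N : ℕ) : ∑ i ∈ Finset.range N, (i : ℝ)⁻¹ ≤ 1 + Real.log N := by
  rcases N with _ | n
  · simp
  · rw [Finset.sum_range_succ']
    have h := harmonic_le_one_add_log n
    rw [harmonic] at h
    push_cast at h
    have h2 : Real.log n ≤ Real.log ((n + 1 : ℕ) : ℝ) := by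
      rcases n.eq_zero_or_pos with rfl | hn
      · simp
      · exact Real.log_le_log (by positivity) (by simp)
    push_cast at h2 ⊢
    simp only [inv_zero, add_zero]
    linarith

/-- The `ℓ₁`-norm of the samples of the Dirichlet kernel on a grid of step `1 / N`. -/
theorem sum_norm_dirichlet_le {M N : ℕ} (hN : 0 < N) (x : ℝ) :
    ∑ j ∈ Finset.range N, ‖dirichlet M (x + j / N)‖ ≤ 2 * M + N * (1 + Real.log N) := by
  have hNR : (0 : ℝ) < N := by exact_mod_cast hN
  -- By periodicity the grid may be re-indexed to the points `(r + i) / N` with `0 ≤ i < N`, all in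
  -- `[0, 1)`.
  set r := Int.fract (N * x) with hr
  set F : ℤ → ℝ := fun i => ‖dirichlet M ((r + i) / N)‖ with hFdef
  have hF : ∀ i, F (i + N) = F i := by
    intro i
    simp only [hFdef]
    rw [← dirichlet_add_one M ((r + i) / N)]
    congr 2; push_cast; field_simp; ring
  have h1 : ∀ j : ℕ, ‖dirichlet M (x + j / N)‖ = F (⌊N * x⌋ + j) := by
    intro j
    simp only [hFdef]
    congr 2
    have := Int.floor_add_fract (N * x)
    push_cast
    rw [hr, eq_div_iff hNR.ne', add_mul, div_mul_cancel₀ _ hNR.ne']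
    linarith
  simp_rw [h1]
  rw [sum_range_add_of_periodic hF]
  have hr0 : 0 ≤ r := Int.fract_nonneg _
  have hr1 : r < 1 := Int.fract_lt_one _
  -- The first and last points may be close to an integer and cost the trivial bound `M`; the others
  -- give harmonic terms. The convention `0⁻¹ = 0` makes the singular harmonic terms vanish.
  have hb : ∀ i ∈ Finset.range N, F i ≤ (if i = 0 then (M : ℝ) else 0)
      + (if i = N - 1 then (M : ℝ) else 0)
      + N / 2 * ((i : ℝ)⁻¹ + ((N - 1 - i : ℕ) : ℝ)⁻¹) := by
    intro i hi
    rw [Finset.mem_range] at hi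
    have hFM : F i ≤ M := norm_dirichlet_le _ _
    have hpos : 0 ≤ N / 2 * ((i : ℝ)⁻¹ + ((N - 1 - i : ℕ) : ℝ)⁻¹) := by positivity
    have hM : (0 : ℝ) ≤ M := by positivity
    by_cases hi0 : i = 0
    · rw [if_pos hi0]
      split_ifs <;> linarith only [hFM, hpos, hM]
    by_cases hi1 : i = N - 1
    · rw [if_pos hi1]
      rw [if_neg hi0]
      linarith
    rw [if_neg hi0, if_neg hi1, zero_add, zero_add]
    have hiR : (0 : ℝ) < i := by exact_mod_cast Nat.pos_of_ne_zero hi0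
    have hk : (0 : ℝ) < ((N - 1 - i : ℕ) : ℝ) := by
      have : 0 < N - 1 - i := by omega
      exact_mod_cast this
    have hkR : ((N - 1 - i : ℕ) : ℝ) = N - 1 - i := by
      rw [Nat.cast_sub (by omega), Nat.cast_sub (by omega)]; simp
    have hx0 : 0 < (r + i) / N := by positivity
    have hx1 : (r + i) / N < 1 := by rw [div_lt_one hNR]; linarith
    refine (norm_dirichlet_le_of_mem_Ioo M (x := (r + (i : ℤ)) / N)
      (by exact_mod_cast hx0) (by exact_mod_cast hx1)).trans ?_
    rw [mul_add]
    push_cast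
    refine add_le_add ?_ ?_
    · rw [← div_eq_mul_inv, ← one_div, div_le_div_iff₀ (by positivity) hiR]
      have : 2 * ((r + i) / N) * N = 2 * (r + i) := by field_simp
      nlinarith
    · rw [← div_eq_mul_inv, ← one_div, div_le_div_iff₀ (by linarith) hk]
      have : 2 * (1 - (r + i) / N) * N = 2 * (N - (r + i)) := by field_simp
      nlinarith
  refine (Finset.sum_le_sum hb).trans ?_
  rw [Finset.sum_add_distrib, Finset.sum_add_distrib, ← Finset.mul_sum, Finset.sum_add_distrib,
    Finset.sum_range_reflect (fun i : ℕ => (i : ℝ)⁻¹) N, Finset.sum_ite_eq', Finset.sum_ite_eq',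
    if_pos (by simpa using hN), if_pos (by simp [hN])]
  nlinarith [sum_range_inv_le N]

/-! ### The Fourier basis -/

/-- The `k`-th vector of the unitary Fourier basis of `ℂ^N`. -/
noncomputable def fourierVec (N : ℕ) (k : Fin N) : EuclideanSpace ℂ (Fin N) :=
  WithLp.toLp 2 fun t => ((√(N : ℝ))⁻¹ : ℝ) * Complex.exp (-(2 * Real.pi * Complex.I * k * t / N))

theorem orthonormal_fourierVec (N : ℕ) : Orthonormal ℂ (fourierVec N) := by
  rw [orthonormal_iff_ite]
  intro k l
  have hN : 0 < N := k.pos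
  have hNC : (N : ℂ) ≠ 0 := by exact_mod_cast hN.ne'
  set ω := Complex.exp (2 * Real.pi * Complex.I * (((k : ℕ) : ℂ) - ((l : ℕ) : ℂ)) / N) with hω
  have h1 : inner ℂ (fourierVec N k) (fourierVec N l)
      = (N : ℂ)⁻¹ * ∑ t ∈ Finset.range N, ω ^ t := by
    rw [← Fin.sum_univ_eq_sum_range (fun t => ω ^ t), PiLp.inner_apply, Finset.mul_sum]
    refine Finset.sum_congr rfl fun t _ => ?_
    simp only [fourierVec, RCLike.inner_apply, map_mul, Complex.conj_ofReal, ← Complex.exp_conj]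
    have h2 : ((√(N : ℝ) : ℂ))⁻¹ * ((√(N : ℝ) : ℂ))⁻¹ = (N : ℂ)⁻¹ := by
      rw [← mul_inv, ← Complex.ofReal_mul, Real.mul_self_sqrt (by positivity)]
      simp
    have h3 : ω ^ (t : ℕ) = Complex.exp (-(2 * Real.pi * Complex.I * l * t / N))
        * Complex.exp ((starRingEnd ℂ) (-(2 * Real.pi * Complex.I * k * t / N))) := by
      rw [hω, ← Complex.exp_nat_mul, ← Complex.exp_add]
      congr 1
      simp only [map_neg, map_div₀, map_mul, Complex.conj_ofReal, Complex.conj_I, map_natCast,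
        map_ofNat]
      ring
    rw [h3, ← h2]
    push_cast
    ring
  rw [h1]
  split_ifs with hkl
  · have : ω = 1 := by rw [hω, hkl]; simp
    simp [this, hNC]
  · have hne : ω ≠ 1 := by
      intro h
      rw [hω, Complex.exp_eq_one_iff] at h
      obtain ⟨q, hq⟩ := h
      have hpi : (2 * Real.pi * Complex.I : ℂ) ≠ 0 := Complex.two_pi_I_ne_zero
      rw [mul_div_assoc, mul_comm (q : ℂ)] at hq
      have hq' := mul_left_cancel₀ hpi hq
      rw [div_eq_iff hNC] at hq'
      have hz : ((k : ℕ) : ℤ) - ((l : ℕ) : ℤ) = q * N := by exact_mod_cast hq'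
      have hk := k.isLt
      have hl := l.isLt
      have : ((k : ℕ) : ℤ) - ((l : ℕ) : ℤ) = 0 :=
        Int.eq_zero_of_abs_lt_dvd (Dvd.intro_left _ hz.symm) (by rw [abs_lt]; omega)
      exact hkl (Fin.ext (by omega))
    have hpow : ω ^ N = 1 := by
      rw [hω, ← Complex.exp_nat_mul, Complex.exp_eq_one_iff]
      exact ⟨(k : ℕ) - (l : ℕ), by push_cast; field_simp⟩
    have := geom_sum_mul ω N
    rw [hpow, sub_self, mul_eq_zero, sub_eq_zero] at this
    rw [this.resolve_right hne, mul_zero]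

/-- The unitary Fourier basis of `ℂ^N`. -/
noncomputable def fourierBasis (N : ℕ) : OrthonormalBasis (Fin N) ℂ (EuclideanSpace ℂ (Fin N)) :=
  OrthonormalBasis.mk (orthonormal_fourierVec N)
    ((orthonormal_fourierVec N).linearIndependent.span_eq_top_of_card_eq_finrank' (by simp)).ge

theorem fourierBasis_apply (N : ℕ) (k : Fin N) : fourierBasis N k = fourierVec N k := by
  simp [fourierBasis]

/-! ### Windows of sequences and filters -/

/-- The window `(x_0, …, x_n)` as a vector of the Euclidean space. -/
noncomputable def window (n : ℕ) : (ℤ → ℂ) →ₗ[ℂ] EuclideanSpace ℂ (Fin (n + 1)) where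
  toFun x := WithLp.toLp 2 fun t => x (t : ℕ)
  map_add' _ _ := rfl
  map_smul' _ _ := rfl

@[simp] theorem window_apply (n : ℕ) (x : ℤ → ℂ) (t : Fin (n + 1)) :
    window n x t = x (t : ℕ) := rfl

theorem windowNorm_eq (n : ℕ) (x : ℤ → ℂ) : windowNorm n x = ‖window n x‖ := by
  rw [windowNorm, EuclideanSpace.norm_eq, ← Fin.sum_univ_eq_sum_range (fun t => ‖x (t : ℤ)‖ ^ 2)]
  rfl

theorem iterate_shift_apply (τ : ℕ) (x : ℤ → ℂ) (t : ℤ) : shift^[τ] x t = x (t - τ) := by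
  induction τ generalizing t with
  | zero => simp
  | succ τ ih =>
    rw [Function.iterate_succ_apply', shift, ih]
    congr 1; push_cast; ring

/-- The inner product conjugates its first argument, so the minus sign in `fourierVec` becomes the
plus sign of `dft`. -/
theorem dft_eq_inner (m : ℕ) (x : ℤ → ℂ) (k : Fin (m + 1)) :
    dft m x k = inner ℂ (fourierVec (m + 1) k) (window m x) := by
  rw [dft, ← Fin.sum_univ_eq_sum_range (fun t => x (t : ℤ) *
    Complex.exp (2 * Real.pi * Complex.I * k * t / (m + 1))), PiLp.inner_apply, Finset.mul_sum]
  refine Finset.sum_congr rfl fun t _ => ?_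
  simp only [fourierVec, RCLike.inner_apply, map_mul, Complex.conj_ofReal, ← Complex.exp_conj,
    window_apply]
  rw [show (starRingEnd ℂ) (-(2 * Real.pi * Complex.I * k * t / ((m + 1 : ℕ) : ℂ)))
    = 2 * Real.pi * Complex.I * k * t / (m + 1) by
      simp only [map_neg, map_div₀, map_mul, Complex.conj_ofReal, Complex.conj_I, map_natCast,
        map_ofNat]
      push_cast
      ring]
  push_cast
  ring

theorem fourierL1_eq (m : ℕ) (x : ℤ → ℂ) :
    fourierL1 m x = ∑ k, ‖inner ℂ (fourierVec (m + 1) k) (window m x)‖ := by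
  rw [fourierL1, ← Fin.sum_univ_eq_sum_range (fun k => ‖dft m x k‖)]
  simp_rw [dft_eq_inner]

/-- Parseval, followed by the comparison of the `ℓ₂` and `ℓ₁` norms. -/
theorem norm_window_le_fourierL1 (m : ℕ) (x : ℤ → ℂ) : ‖window m x‖ ≤ fourierL1 m x := by
  have h : ∑ k, ‖inner ℂ (fourierVec (m + 1) k) (window m x)‖ ^ 2 = ‖window m x‖ ^ 2 := by
    simpa only [fourierBasis_apply] using (fourierBasis (m + 1)).sum_sq_norm_inner_right
      (window m x)
  rw [fourierL1_eq]
  refine le_of_sq_le_sq ?_ (by positivity)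
  rw [← h]
  exact Finset.sum_sq_le_sq_sum_of_nonneg fun _ _ => norm_nonneg _

theorem conv_apply {m : ℕ} {φ : ℤ → ℂ} (hφ : φ ∈ filters m) (y : ℤ → ℂ) (t : ℤ) :
    conv φ y t = ∑ τ : Fin (m + 1), φ (τ : ℕ) * y (t - (τ : ℕ)) := by
  rw [conv, tsum_eq_sum (s := (Finset.range (m + 1)).map Nat.castEmbedding), Finset.sum_map,
    ← Fin.sum_univ_eq_sum_range
      (fun τ => φ (Nat.castEmbedding τ) * y (t - (Nat.castEmbedding τ : ℤ)))]
  · rfl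
  · intro τ hτ
    rw [hφ τ, zero_mul]
    intro hmem
    apply hτ
    rw [Finset.mem_map]
    have := hmem.1
    have := hmem.2
    exact ⟨τ.toNat, by simp only [Finset.mem_range]; omega,
      by simp only [Nat.castEmbedding_apply]; omega⟩

theorem conv_eq_sum {m : ℕ} {φ : ℤ → ℂ} (hφ : φ ∈ filters m) (y : ℤ → ℂ) :
    conv φ y = ∑ τ : Fin (m + 1), φ (τ : ℕ) • shift^[(τ : ℕ)] y := by
  ext t
  rw [conv_apply hφ, Finset.sum_apply]
  simp [iterate_shift_apply]

theorem window_conv {m : ℕ} (n : ℕ) {φ : ℤ → ℂ} (hφ : φ ∈ filters m) (y : ℤ → ℂ) :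
    window n (conv φ y) = ∑ τ : Fin (m + 1), window m φ τ • window n (shift^[(τ : ℕ)] y) := by
  rw [conv_eq_sum hφ, map_sum]
  simp

/-- The window of the output of the filter given by the `k`-th Fourier vector. -/
noncomputable def fourierOutput (m n : ℕ) (k : Fin (m + 1)) (u : ℤ → ℂ) :
    EuclideanSpace ℂ (Fin (n + 1)) :=
  ∑ τ : Fin (m + 1), fourierVec (m + 1) k τ • window n (shift^[(τ : ℕ)] u)

/-- The absolute values of the coefficients add up to `‖φ‖*`, so a bound uniform over all filters
reduces to the `m + 1` Fourier filters. -/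
theorem window_conv_eq_fourierOutput {m : ℕ} (n : ℕ) {φ : ℤ → ℂ} (hφ : φ ∈ filters m)
    (y : ℤ → ℂ) :
    window n (conv φ y) = ∑ k, inner ℂ (fourierVec (m + 1) k) (window m φ) •
      fourierOutput m n k y := by
  rw [window_conv n hφ]
  have h : ∀ τ, window m φ τ
      = ∑ k, inner ℂ (fourierVec (m + 1) k) (window m φ) * fourierVec (m + 1) k τ := by
    intro τ
    have := congrArg (fun v : EuclideanSpace ℂ (Fin (m + 1)) => v τ)
      ((fourierBasis (m + 1)).sum_repr' (window m φ))
    simpa [fourierBasis_apply] using this.symm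
  simp_rw [fourierOutput, Finset.smul_sum, smul_smul]
  rw [Finset.sum_comm]
  refine Finset.sum_congr rfl fun τ _ => ?_
  rw [← Finset.sum_smul, ← h]

/-! ### Cyclic diagonalization of the Fourier filters. -/

/-- The vector `(z_{-m}, …, z_n)`. -/
noncomputable def noiseVec (m n : ℕ) (z : ℤ → ℂ) : EuclideanSpace ℂ (Fin (m + n + 1)) :=
  WithLp.toLp 2 fun i => z ((i : ℕ) - m)

/-- The last `n + 1` coordinates of a vector of length `m + n + 1`. -/
noncomputable def lastCoords (m n : ℕ) :
    EuclideanSpace ℂ (Fin (m + n + 1)) →ₗ[ℂ] EuclideanSpace ℂ (Fin (n + 1)) where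
  toFun v := WithLp.toLp 2 fun t => v ⟨t + m, by omega⟩
  map_add' _ _ := rfl
  map_smul' _ _ := rfl

@[simp] theorem lastCoords_apply (m n : ℕ) (v : EuclideanSpace ℂ (Fin (m + n + 1)))
    (t : Fin (n + 1)) : lastCoords m n v t = v ⟨t + m, by omega⟩ := rfl

theorem norm_lastCoords_le (m n : ℕ) (v : EuclideanSpace ℂ (Fin (m + n + 1))) :
    ‖lastCoords m n v‖ ≤ ‖v‖ := by
  rw [EuclideanSpace.norm_eq, EuclideanSpace.norm_eq]
  refine Real.sqrt_le_sqrt ?_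
  let e : Fin (n + 1) ↪ Fin (m + n + 1) :=
    ⟨fun t => ⟨t + m, by omega⟩, fun a b h => by
      simp only [Fin.mk.injEq] at h
      exact Fin.ext (by omega)⟩
  calc _ = ∑ i ∈ Finset.univ.map e, ‖v i‖ ^ 2 := by
        rw [Finset.sum_map]; rfl
    _ ≤ _ := Finset.sum_le_sum_of_subset_of_nonneg (Finset.subset_univ _)
        fun _ _ _ => by positivity

theorem lastCoords_noiseVec (m n : ℕ) (z : ℤ → ℂ) :
    lastCoords m n (noiseVec m n z) = window n z := by
  ext t
  simp [noiseVec]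

/-- The transfer coefficients: the response of the `k`-th Fourier filter of length `m + 1` at the
`j`-th Fourier frequency of a window of length `N`. -/
noncomputable def transfer (m N : ℕ) (k : Fin (m + 1)) (j : Fin N) : ℂ :=
  ∑ τ : Fin (m + 1), fourierVec (m + 1) k τ * Complex.exp (2 * Real.pi * Complex.I * j * τ / N)

theorem norm_transfer (m N : ℕ) (k : Fin (m + 1)) (j : Fin N) :
    ‖transfer m N k j‖
      = (√((m : ℝ) + 1))⁻¹ * ‖dirichlet (m + 1) (-(k / ((m : ℝ) + 1)) + (j : ℕ) / N)‖ := by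
  have h : transfer m N k j = ((√((m : ℝ) + 1))⁻¹ : ℝ)
      * dirichlet (m + 1) (-(k / ((m : ℝ) + 1)) + (j : ℕ) / N) := by
    rw [transfer, dirichlet, Finset.mul_sum, ← Fin.sum_univ_eq_sum_range
      (fun τ => (((√((m : ℝ) + 1))⁻¹ : ℝ) : ℂ) * Complex.exp (2 * Real.pi * Complex.I * τ *
        ((-(k / ((m : ℝ) + 1)) + (j : ℕ) / N : ℝ) : ℂ)))]
    refine Finset.sum_congr rfl fun τ _ => ?_
    simp only [fourierVec]
    rw [mul_assoc, ← Complex.exp_add]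
    push_cast
    congr 2
    ring
  rw [h, norm_mul, Complex.norm_real, Real.norm_of_nonneg (by positivity)]

theorem norm_transfer_le (m N : ℕ) (k : Fin (m + 1)) (j : Fin N) :
    ‖transfer m N k j‖ ≤ √((m : ℝ) + 1) := by
  rw [norm_transfer, inv_mul_le_iff₀ (by positivity), Real.mul_self_sqrt (by positivity)]
  exact_mod_cast norm_dirichlet_le (m + 1) _

theorem sum_norm_transfer_le (m N : ℕ) (hN : 0 < N) (k : Fin (m + 1)) :
    ∑ j, ‖transfer m N k j‖
      ≤ √((m : ℝ) + 1) * (2 + N / ((m : ℝ) + 1) * (1 + Real.log N)) := by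
  simp_rw [norm_transfer]
  rw [← Finset.mul_sum, Fin.sum_univ_eq_sum_range
    (fun j => ‖dirichlet (m + 1) (-(k / ((m : ℝ) + 1)) + j / N)‖), inv_mul_le_iff₀ (by positivity),
    ← mul_assoc, Real.mul_self_sqrt (by positivity)]
  refine (sum_norm_dirichlet_le hN _).trans (le_of_eq ?_)
  push_cast
  field_simp

/-- The filter looks back at most `m` steps, so on the last `n + 1` coordinates no index wraps
around: the output agrees with a cyclic convolution of length `m + n + 1`, which is diagonal in the
Fourier basis. -/
theorem fourierOutput_eq (m n : ℕ) (k : Fin (m + 1)) (z : ℤ → ℂ) :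
    fourierOutput m n k z = lastCoords m n (∑ j, (transfer m (m + n + 1) k j *
      inner ℂ (fourierVec (m + n + 1) j) (noiseVec m n z)) • fourierVec (m + n + 1) j) := by
  ext t
  set Z := noiseVec m n z with hZ
  have hinv : ∀ i, Z i
      = ∑ j, inner ℂ (fourierVec (m + n + 1) j) Z * fourierVec (m + n + 1) j i := by
    intro i
    have := congrArg (fun v : EuclideanSpace ℂ (Fin (m + n + 1)) => v i)
      ((fourierBasis (m + n + 1)).sum_repr' Z)
    simpa [fourierBasis_apply] using this.symm
  have hz : ∀ τ : Fin (m + 1), z ((t : ℕ) - (τ : ℕ))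
      = ∑ j, inner ℂ (fourierVec (m + n + 1) j) Z * (fourierVec (m + n + 1) j ⟨t + m, by omega⟩ *
        Complex.exp (2 * Real.pi * Complex.I * j * τ / ((m + n + 1 : ℕ) : ℂ))) := by
    intro τ
    have h1 : z ((t : ℕ) - (τ : ℕ)) = Z ⟨t + m - τ, by omega⟩ := by
      rw [hZ, noiseVec]
      change _ = z _
      congr 1
      push_cast [show (τ : ℕ) ≤ t + m by omega]
      ring
    rw [h1, hinv]
    refine Finset.sum_congr rfl fun j _ => ?_
    congr 1
    simp only [fourierVec]
    rw [mul_assoc (((√((m + n + 1 : ℕ) : ℝ))⁻¹ : ℝ) : ℂ), ← Complex.exp_add]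
    congr 2
    push_cast [show (τ : ℕ) ≤ t + m by omega]
    ring
  simp only [fourierOutput, WithLp.ofLp_sum, WithLp.ofLp_smul, Finset.sum_apply, Pi.smul_apply,
    smul_eq_mul, window_apply, lastCoords_apply, iterate_shift_apply, hz, transfer,
    Finset.sum_mul, Finset.mul_sum]
  rw [Finset.sum_comm]
  refine Finset.sum_congr rfl fun j _ => Finset.sum_congr rfl fun τ _ => ?_
  ring

/-! ### The deterministic oracle inequality -/

theorem conv_add_right {m : ℕ} {φ : ℤ → ℂ} (hφ : φ ∈ filters m) (u v : ℤ → ℂ) :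
    conv φ (u + v) = conv φ u + conv φ v := by
  ext t
  simp only [conv_apply hφ, Pi.add_apply, mul_add, Finset.sum_add_distrib]

theorem conv_smul_right {m : ℕ} {φ : ℤ → ℂ} (hφ : φ ∈ filters m) (c : ℂ) (u : ℤ → ℂ) :
    conv φ (c • u) = c • conv φ u := by
  ext t
  simp only [conv_apply hφ, Pi.smul_apply, smul_eq_mul, Finset.mul_sum]
  exact Finset.sum_congr rfl fun τ _ => by ring

theorem conv_mem_of_shift_mem {m : ℕ} {φ : ℤ → ℂ} (hφ : φ ∈ filters m)
    {S : Submodule ℂ (ℤ → ℂ)} (hS : ∀ u ∈ S, shift u ∈ S) {u : ℤ → ℂ} (hu : u ∈ S) :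
    conv φ u ∈ S := by
  rw [conv_eq_sum hφ]
  refine S.sum_mem fun τ _ => S.smul_mem _ ?_
  induction (τ : ℕ) with
  | zero => simpa
  | succ k ih =>
    rw [Function.iterate_succ_apply']
    exact hS _ ih

/-- Completing squares in `X` and in `r'` gives `(X - σp)² ≤ (A + σp)² + σ²(λr + B/λ)²`; the unknown
`r'` occurs only in the discarded square `σ²(λr' - B/λ)²`. The conclusion is `√(a² + b²) ≤ a + b`.
-/
theorem le_add_of_sq_le_penalized {X A σ p lam r r' B : ℝ} (hA : 0 ≤ A) (hσ : 0 ≤ σ)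
    (hp : 0 ≤ p) (hlam : 0 < lam) (hr : 0 ≤ r) (hB : 0 ≤ B)
    (h : X ^ 2 ≤ A ^ 2 + 2 * σ * (p * (A + X) + σ * (r' + r) * B)
      + lam ^ 2 * σ ^ 2 * (r ^ 2 - r' ^ 2)) :
    X ≤ A + 2 * σ * p + σ * (lam * r + lam⁻¹ * B) := by
  set u := lam⁻¹ with hu
  have hlu : lam * u = 1 := mul_inv_cancel₀ hlam.ne'
  have hu0 : 0 < u := inv_pos.2 hlam
  have h1 : (X - σ * p) ^ 2 ≤ (A + σ * p) ^ 2 + (σ * (lam * r + u * B)) ^ 2 := by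
    have e : (A + σ * p) ^ 2 + (σ * (lam * r + u * B)) ^ 2 - (X - σ * p) ^ 2
        = (A ^ 2 + 2 * σ * (p * (A + X) + σ * (r' + r) * B)
          + lam ^ 2 * σ ^ 2 * (r ^ 2 - r' ^ 2) - X ^ 2) + (σ * (lam * r' - u * B)) ^ 2
          + (lam * u - 1) * (2 * σ ^ 2 * B * (r + r')) := by ring
    rw [hlu, sub_self, zero_mul, add_zero] at e
    nlinarith [sq_nonneg (σ * (lam * r' - u * B))]
  have hR : 0 ≤ σ * (lam * r + u * B) := by positivity
  have hA' : 0 ≤ A + σ * p := by positivity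
  have h2 : (X - σ * p) ^ 2 ≤ (A + σ * p + σ * (lam * r + u * B)) ^ 2 := by
    nlinarith [mul_nonneg hA' hR]
  have h3 := le_of_abs_le (abs_le_of_sq_le_sq h2 (by positivity))
  linarith

/-- The correlation of the output of a filter with a direction orthogonal to the windows of the
shift-invariant subspace. -/
theorem norm_inner_window_conv_le {m n : ℕ} {σ Bε Bz : ℝ} (hσ : 0 ≤ σ) (hBε : 0 ≤ Bε)
    {S : Submodule ℂ (ℤ → ℂ)} (hS : ∀ u ∈ S, shift u ∈ S) {xS ε z : ℤ → ℂ} (hxS : xS ∈ S)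
    {v : EuclideanSpace ℂ (Fin (n + 1))} (hv : v ∈ (S.map (window n))ᗮ)
    (hε : ∑ τ : Fin (m + 1), ‖inner ℂ (window n (shift^[(τ : ℕ)] ε)) v‖ ^ 2
      ≤ ((m : ℝ) + 1) * (Bε * σ) ^ 2)
    (hz : ∀ k, ‖inner ℂ v (fourierOutput m n k z)‖ ≤ √((m : ℝ) + 1) * Bz)
    {φ : ℤ → ℂ} (hφ : φ ∈ filters m) :
    ‖inner ℂ v (window n (conv φ (xS + ε + (σ : ℂ) • z)))‖
      ≤ σ * (√((m : ℝ) + 1) * fourierL1 m φ) * (Bε + Bz) := by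
  rw [conv_add_right hφ, conv_add_right hφ, conv_smul_right hφ, map_add, map_add, map_smul,
    inner_add_right, inner_add_right, inner_smul_right]
  -- Shift invariance: filtering keeps `xS` in `S`, whose windows are orthogonal to `v`.
  have h0 : inner ℂ v (window n (conv φ xS)) = 0 :=
    (Submodule.mem_orthogonal' _ _).1 hv _
      (Submodule.mem_map_of_mem (conv_mem_of_shift_mem hφ hS hxS))
  -- Cauchy-Schwarz over the lags, with the `ℓ₂` norm of the filter bounded by `‖φ‖*`.
  have h1 : ‖inner ℂ v (window n (conv φ ε))‖ ≤ fourierL1 m φ * (√((m : ℝ) + 1) * (Bε * σ)) := by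
    rw [window_conv n hφ, inner_sum]
    calc _ ≤ ∑ τ : Fin (m + 1), ‖window m φ τ‖ * ‖inner ℂ (window n (shift^[(τ : ℕ)] ε)) v‖ := by
          refine (norm_sum_le _ _).trans (Finset.sum_le_sum fun τ _ => ?_)
          rw [inner_smul_right, norm_mul, norm_inner_symm]
      _ ≤ √(∑ τ, ‖window m φ τ‖ ^ 2)
          * √(∑ τ : Fin (m + 1), ‖inner ℂ (window n (shift^[(τ : ℕ)] ε)) v‖ ^ 2) :=
        Real.sum_mul_le_sqrt_mul_sqrt _ _ _
      _ ≤ fourierL1 m φ * √(((m : ℝ) + 1) * (Bε * σ) ^ 2) := by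
        rw [← EuclideanSpace.norm_eq]
        have := norm_window_le_fourierL1 m φ
        gcongr
        exact (norm_nonneg _).trans this
      _ = _ := by
        rw [Real.sqrt_mul (by positivity), Real.sqrt_sq (by positivity)]
  have h2 : ‖inner ℂ v (window n (conv φ z))‖ ≤ fourierL1 m φ * (√((m : ℝ) + 1) * Bz) := by
    rw [window_conv_eq_fourierOutput n hφ, inner_sum, fourierL1_eq, Finset.sum_mul]
    refine (norm_sum_le _ _).trans (Finset.sum_le_sum fun k _ => ?_)
    rw [inner_smul_right, norm_mul]
    gcongr
    exact hz k
  rw [h0, zero_add]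
  refine (norm_add_le _ _).trans ?_
  rw [norm_mul, Complex.norm_real, Real.norm_of_nonneg hσ]
  nlinarith [mul_le_mul_of_nonneg_left h2 hσ]

theorem windowNorm_sub_conv_le_of_isPenalizedSolution {m n : ℕ} {σ lam p Bε Bz : ℝ} (hσ : 0 ≤ σ)
    (hlam : 0 < lam) (hp : 0 ≤ p) (hBε : 0 ≤ Bε) (hBz : 0 ≤ Bz)
    {S : Submodule ℂ (ℤ → ℂ)} (hS : ∀ u ∈ S, shift u ∈ S) {xS ε z : ℤ → ℂ} (hxS : xS ∈ S)
    (hproj : ‖(S.map (window n)).starProjection (window n z)‖ ≤ p)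
    (hε : ∑ τ : Fin (m + 1), ‖inner ℂ (window n (shift^[(τ : ℕ)] ε))
      ((S.map (window n))ᗮ.starProjection (window n z))‖ ^ 2 ≤ ((m : ℝ) + 1) * (Bε * σ) ^ 2)
    (hz : ∀ k, ‖inner ℂ ((S.map (window n))ᗮ.starProjection (window n z))
      (fourierOutput m n k z)‖ ≤ √((m : ℝ) + 1) * Bz)
    {y φ φhat : ℤ → ℂ} (hy : ∀ t, y t = (xS + ε) t + σ * z t) (hφ : φ ∈ filters m)
    (hφhat : IsPenalizedSolution m n lam σ y φhat) :
    windowNorm n (xS + ε - conv φhat y) ≤ windowNorm n (xS + ε - conv φ y) + 2 * σ * p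
      + σ * (lam * (√((m : ℝ) + 1) * fourierL1 m φ) + lam⁻¹ * (Bε + Bz)) := by
  obtain ⟨hφhat, hopt⟩ := hφhat
  have hy' : y = xS + ε + (σ : ℂ) • z := funext hy
  set K := S.map (window n) with hK
  set ζ := window n z with hζ
  have hF : ∀ ψ, 0 ≤ fourierL1 m ψ := fun ψ => Finset.sum_nonneg fun _ _ => norm_nonneg _
  have hcorr : ∀ ψ ∈ filters m, ‖inner ℂ (Kᗮ.starProjection ζ) (window n (conv ψ y))‖
      ≤ σ * (√((m : ℝ) + 1) * fourierL1 m ψ) * (Bε + Bz) := by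
    intro ψ hψ
    rw [hy']
    exact norm_inner_window_conv_le hσ hBε hS hxS (Submodule.starProjection_apply_mem _ _) hε hz hψ
  -- The term `σ²‖ζ‖²` does not depend on the filter and cancels when two objectives are compared.
  have hres : ∀ ψ, windowNorm n (y - conv ψ y) ^ 2
      = windowNorm n (xS + ε - conv ψ y) ^ 2
        + 2 * σ * (inner ℂ (window n (xS + ε - conv ψ y)) ζ).re + σ ^ 2 * ‖ζ‖ ^ 2 := by
    intro ψ
    have h : window n (y - conv ψ y) = window n (xS + ε - conv ψ y) + (σ : ℂ) • ζ := by
      rw [hζ, ← map_smul, ← map_add]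
      congr 1
      nth_rewrite 1 [hy']
      abel
    rw [windowNorm_eq, windowNorm_eq, h, norm_add_sq (𝕜 := ℂ), inner_smul_right, norm_smul,
      Complex.norm_real, mul_pow, Real.norm_eq_abs, sq_abs]
    simp only [Complex.re_ofReal_mul, RCLike.re_eq_complex_re]
    ring
  have hmin := hopt φ hφ
  rw [penalizedObjective, penalizedObjective, hres, hres] at hmin
  rw [windowNorm_eq, windowNorm_eq] at hmin ⊢
  set a := window n (xS + ε - conv φ y) with ha
  set X := window n (xS + ε - conv φhat y) with hX
  have haX : a - X = window n (conv φhat y) - window n (conv φ y) := by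
    rw [ha, hX, map_sub, map_sub]; abel
  have hD : (inner ℂ (a - X) ζ).re ≤ p * (‖a‖ + ‖X‖)
      + σ * (√((m : ℝ) + 1) * fourierL1 m φhat + √((m : ℝ) + 1) * fourierL1 m φ) * (Bε + Bz) := by
    -- The component in `K` is paired with `a - X` directly, giving `p (‖a‖ + ‖X‖)`; the orthogonal
    -- one goes through the two filters separately.
    have hsplit : ζ = K.starProjection ζ + Kᗮ.starProjection ζ :=
      (K.starProjection_add_starProjection_orthogonal ζ).symm
    have e1 : (inner ℂ (a - X) (K.starProjection ζ)).re ≤ p * (‖a‖ + ‖X‖) := by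
      refine (Complex.re_le_norm _).trans ((norm_inner_le_norm _ _).trans ?_)
      rw [mul_comm]
      gcongr
      exact norm_sub_le _ _
    have e2 : (inner ℂ (a - X) (Kᗮ.starProjection ζ)).re
        ≤ σ * (√((m : ℝ) + 1) * fourierL1 m φhat + √((m : ℝ) + 1) * fourierL1 m φ)
          * (Bε + Bz) := by
      refine (Complex.re_le_norm _).trans ?_
      rw [norm_inner_symm, haX, inner_sub_right]
      refine (norm_sub_le _ _).trans ?_
      linarith [hcorr φ hφ, hcorr φhat hφhat]
    rw [hsplit, inner_add_right, Complex.add_re]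
    exact add_le_add e1 e2
  have hM : (0 : ℝ) ≤ √((m : ℝ) + 1) := Real.sqrt_nonneg _
  refine le_add_of_sq_le_penalized (r' := √((m : ℝ) + 1) * fourierL1 m φhat) (norm_nonneg _) hσ hp
    hlam (mul_nonneg hM (hF φ)) (by positivity) ?_
  have h5 : (inner ℂ (a - X) ζ).re = (inner ℂ a ζ).re - (inner ℂ X ζ).re := by
    rw [inner_sub_left, Complex.sub_re]
  nlinarith [mul_le_mul_of_nonneg_left hD hσ]

/-! ### Tail bounds for the noise -/

section Tails

variable {ι : Type*} [Fintype ι] {F : Type*} [NormedAddCommGroup F] [InnerProductSpace ℂ F]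
  [FiniteDimensional ℂ F]

theorem norm_adjoint_apply_le {A : EuclideanSpace ℂ ι →ₗ[ℂ] F} (hA : ∀ x, ‖A x‖ ≤ ‖x‖) (y : F) :
    ‖LinearMap.adjoint A y‖ ≤ ‖y‖ := by
  by_contra! h
  have h1 : ‖LinearMap.adjoint A y‖ * ‖LinearMap.adjoint A y‖
      = ‖inner ℂ y (A (LinearMap.adjoint A y))‖ := by
    rw [← LinearMap.adjoint_inner_left, ← inner_self_eq_norm_mul_norm (𝕜 := ℂ),
      inner_self_re_eq_norm]
  have h2 := (norm_inner_le_norm (𝕜 := ℂ) y (A (LinearMap.adjoint A y))).trans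
    (mul_le_mul_of_nonneg_left (hA _) (norm_nonneg y))
  nlinarith [norm_nonneg y]

theorem norm_starProjection_sq (K : Submodule ℂ F) (v : F) :
    ‖K.starProjection v‖ ^ 2 = ∑ i, ‖inner ℂ (stdOrthonormalBasis ℂ K i : F) v‖ ^ 2 := by
  rw [Submodule.starProjection_apply, Submodule.norm_coe,
    ← (stdOrthonormalBasis ℂ K).sum_sq_norm_inner_right]
  simp_rw [Submodule.inner_orthogonalProjectionOnto_eq_of_mem_left]

theorem stdGaussian_norm_starProjection_tail {A : EuclideanSpace ℂ ι →ₗ[ℂ] F}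
    (hA : ∀ x, ‖A x‖ ≤ ‖x‖) (K : Submodule ℂ F) {s : ℕ} (hs : 1 ≤ s)
    (hK : Module.finrank ℂ K ≤ s) {c : ℝ} (hc : 0 ≤ c) :
    (stdGaussian (EuclideanSpace ℂ ι)).real {x | √(2 * s) + c < ‖K.starProjection (A x)‖}
      ≤ Real.exp (-(c ^ 2 / 2)) := by
  set q := √(2 * (s : ℝ)) with hq
  have hs' : (1 : ℝ) ≤ s := by exact_mod_cast hs
  have hq0 : 0 < q := Real.sqrt_pos.2 (by positivity)
  have hq2 : q ^ 2 = 2 * s := Real.sq_sqrt (by positivity)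
  set f := fun i => LinearMap.adjoint A (stdOrthonormalBasis ℂ K i : F) with hf
  have hfx : ∀ x, ∑ i, ‖inner ℂ (f i) x‖ ^ 2 = ‖K.starProjection (A x)‖ ^ 2 := by
    intro x
    simp only [hf, LinearMap.adjoint_inner_left, norm_starProjection_sq]
  have hfn : ∑ i, ‖f i‖ ^ 2 ≤ (s : ℝ) := by
    calc _ ≤ ∑ i : Fin (Module.finrank ℂ K), (1 : ℝ) := by
          refine Finset.sum_le_sum fun i _ => ?_
          refine pow_le_one₀ (norm_nonneg _) ((norm_adjoint_apply_le hA _).trans ?_)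
          rw [Submodule.norm_coe, (stdOrthonormalBasis ℂ K).norm_eq_one]
      _ ≤ s := by simpa using hK
  -- With `q = √(2s)`, this `θ` gives `(1 - 2θ)⁻¹ = 1 + c/q`, whose `s`-th power is at most
  -- `e^{sc/q} = e^{qc/2}`. The total exponent is `-c(q + c)/2 + qc/2 = -c²/2`.
  have h := stdGaussian_sum_norm_sq_tail f
    (fun x => by
      rw [hfx]
      gcongr
      exact (Submodule.norm_starProjection_apply_le _ _).trans (hA x))
    (θ := c / (2 * (q + c))) (by positivity)
    (by rw [div_lt_div_iff₀ (by positivity) (by norm_num)]; linarith) hfn ((q + c) ^ 2)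
  have hsub : {x | q + c < ‖K.starProjection (A x)‖}
      ⊆ {x | (q + c) ^ 2 ≤ ∑ j, ‖inner ℂ (f j) x‖ ^ 2} := by
    intro x hx
    simp only [Set.mem_ofPred_eq] at hx ⊢
    rw [hfx]
    gcongr
  refine (measureReal_mono hsub).trans (h.trans ?_)
  have h1 : 1 - 2 * (c / (2 * (q + c))) = (1 + c / q)⁻¹ := by field_simp; ring
  rw [h1, Real.rpow_neg (by positivity), Real.inv_rpow (by positivity), inv_inv, Real.rpow_natCast]
  have h2 : (1 + c / q) ^ s ≤ Real.exp (q * c / 2) := by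
    calc (1 + c / q) ^ s ≤ Real.exp (c / q) ^ s := by
          gcongr
          linarith [Real.add_one_le_exp (c / q)]
      _ = _ := by
        rw [← Real.exp_nat_mul]
        congr 1
        rw [show (s : ℝ) = q ^ 2 / 2 by linarith]
        field_simp
  calc _ ≤ Real.exp (-(c / (2 * (q + c))) * (q + c) ^ 2) * Real.exp (q * c / 2) := by gcongr
    _ = _ := by
      rw [← Real.exp_add]
      congr 1
      field_simp
      ring

/-- Dividing by `W` makes the trace at most one, which also bounds the operator norm; at `θ = 1/4`
the Chernoff prefactor is `(1/2)⁻¹ = 2`, whatever the number of forms. -/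
theorem stdGaussian_sum_inner_sq_tail {J : Type*} [Fintype J] {A : EuclideanSpace ℂ ι →ₗ[ℂ] F}
    (hA : ∀ x, ‖A x‖ ≤ ‖x‖) (g : J → F) {W : ℝ} (hW : 0 ≤ W) (hg : ∑ j, ‖g j‖ ^ 2 ≤ W) (t : ℝ) :
    (stdGaussian (EuclideanSpace ℂ ι)).real {x | W * t < ∑ j, ‖inner ℂ (g j) (A x)‖ ^ 2}
      ≤ 2 * Real.exp (-(t / 4)) := by
  rcases hW.eq_or_lt with rfl | hW
  · have h0 : ∀ j, g j = 0 := by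
      intro j
      have := (Finset.single_le_sum (f := fun j => ‖g j‖ ^ 2) (fun _ _ => by positivity)
        (Finset.mem_univ j)).trans hg
      simpa using le_antisymm this (by positivity)
    simp [h0]
    positivity
  have hWsq : √W ^ 2 = W := Real.sq_sqrt hW.le
  set f := fun j => ((√W)⁻¹ : ℂ) • LinearMap.adjoint A (g j) with hf
  have hfx : ∀ x, ∑ j, ‖inner ℂ (f j) x‖ ^ 2 = W⁻¹ * ∑ j, ‖inner ℂ (g j) (A x)‖ ^ 2 := by
    intro x
    rw [Finset.mul_sum]
    refine Finset.sum_congr rfl fun j _ => ?_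
    simp only [hf, inner_smul_left, LinearMap.adjoint_inner_left, norm_mul, mul_pow, RCLike.norm_conj,
      norm_inv, Complex.norm_real, inv_pow, Real.norm_eq_abs, sq_abs, hWsq]
  have hfn : ∑ j, ‖f j‖ ^ 2 ≤ 1 := by
    have : ∀ j, ‖f j‖ ^ 2 ≤ W⁻¹ * ‖g j‖ ^ 2 := by
      intro j
      simp only [hf, norm_smul, norm_inv, Complex.norm_real, mul_pow, inv_pow, Real.norm_eq_abs,
        sq_abs, hWsq]
      gcongr
      exact norm_adjoint_apply_le hA _
    refine (Finset.sum_le_sum fun j _ => this j).trans ?_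
    rw [← Finset.mul_sum, inv_mul_le_iff₀ hW, mul_one]
    exact hg
  have h := stdGaussian_sum_norm_sq_tail f (fun x => by
      calc _ ≤ ∑ j, ‖f j‖ ^ 2 * ‖x‖ ^ 2 := Finset.sum_le_sum fun j _ => by
            rw [← mul_pow]
            gcongr
            exact norm_inner_le_norm _ _
        _ ≤ _ := by
            rw [← Finset.sum_mul]
            exact mul_le_of_le_one_left (by positivity) hfn)
    (θ := 1 / 4) (by norm_num) (by norm_num) hfn t
  refine (measureReal_mono ?_).trans (h.trans (le_of_eq ?_))
  · intro x hx
    simp only [Set.mem_ofPred_eq] at hx ⊢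
    rw [hfx, ← div_eq_inv_mul, le_div_iff₀ hW, mul_comm]
    exact hx.le
  · rw [Real.rpow_neg_one, mul_comm]
    norm_num
    ring

/-- After division by `L` the weights are at most one, so Bessel bounds the operator norm, and the
trace is at most `Λ`. At `θ = 1/4` the prefactor is `2^Λ ≤ e^Λ`. -/
theorem stdGaussian_weighted_sum_tail {J : Type*} [Fintype J] {A : EuclideanSpace ℂ ι →ₗ[ℂ] F}
    (hA : ∀ x, ‖A x‖ ≤ ‖x‖) {e : J → F} (he : Orthonormal ℂ e) {c : J → ℝ} {L Λ : ℝ}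
    (hL : 0 < L) (hc : ∀ j, 0 ≤ c j) (hcL : ∀ j, c j ≤ L) (hsum : ∑ j, c j ≤ L * Λ) (t : ℝ) :
    (stdGaussian (EuclideanSpace ℂ ι)).real {x | L * t < ∑ j, c j * ‖inner ℂ (e j) (A x)‖ ^ 2}
      ≤ Real.exp (Λ - t / 4) := by
  have hsq : ∀ j, √(c j / L) ^ 2 = c j / L := fun j =>
    Real.sq_sqrt (div_nonneg (hc j) hL.le)
  set f := fun j => (√(c j / L) : ℂ) • LinearMap.adjoint A (e j) with hf
  have hfx : ∀ x, ∑ j, ‖inner ℂ (f j) x‖ ^ 2 = ∑ j, c j / L * ‖inner ℂ (e j) (A x)‖ ^ 2 := by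
    intro x
    refine Finset.sum_congr rfl fun j _ => ?_
    simp only [hf, inner_smul_left, LinearMap.adjoint_inner_left, norm_mul, mul_pow,
      RCLike.norm_conj, Complex.norm_real, Real.norm_eq_abs, sq_abs, hsq]
  have hfn : ∑ j, ‖f j‖ ^ 2 ≤ Λ := by
    have : ∀ j, ‖f j‖ ^ 2 ≤ c j / L := by
      intro j
      simp only [hf, norm_smul, Complex.norm_real, mul_pow, Real.norm_eq_abs, sq_abs, hsq]
      refine mul_le_of_le_one_right (div_nonneg (hc j) hL.le) (pow_le_one₀ (norm_nonneg _) ?_)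
      exact (norm_adjoint_apply_le hA _).trans (he.1 j).le
    refine (Finset.sum_le_sum fun j _ => this j).trans ?_
    rw [← Finset.sum_div, div_le_iff₀ hL, mul_comm]
    exact hsum
  have h := stdGaussian_sum_norm_sq_tail f (fun x => by
      rw [hfx]
      calc _ ≤ ∑ j, ‖inner ℂ (e j) (A x)‖ ^ 2 := Finset.sum_le_sum fun j _ =>
            mul_le_of_le_one_left (by positivity) ((div_le_one hL).2 (hcL j))
        _ ≤ ‖A x‖ ^ 2 := he.sum_inner_products_le _
        _ ≤ _ := by
            gcongr
            exact hA x)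
    (θ := 1 / 4) (by norm_num) (by norm_num) hfn t
  have hΛ : 0 ≤ Λ := le_trans (Finset.sum_nonneg fun _ _ => by positivity) hfn
  refine (measureReal_mono ?_).trans (h.trans ?_)
  · intro x hx
    simp only [Set.mem_ofPred_eq] at hx ⊢
    rw [hfx]
    have : ∑ j, c j / L * ‖inner ℂ (e j) (A x)‖ ^ 2
        = (∑ j, c j * ‖inner ℂ (e j) (A x)‖ ^ 2) / L := by
      rw [Finset.sum_div]
      exact Finset.sum_congr rfl fun j _ => by ring
    rw [this, le_div_iff₀ hL, mul_comm]
    exact hx.le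
  · have h2 : (1 - 2 * (1 / 4) : ℝ) ^ (-Λ) ≤ Real.exp Λ := by
      rw [show (1 - 2 * (1 / 4) : ℝ) = 2⁻¹ by norm_num, Real.rpow_neg (by positivity),
        Real.inv_rpow (by norm_num), inv_inv, ← Real.exp_one_rpow]
      exact Real.rpow_le_rpow (by norm_num) (by linarith [Real.add_one_le_exp 1]) hΛ
    calc _ ≤ Real.exp (-(1 / 4) * t) * Real.exp Λ := by gcongr
      _ = _ := by
        rw [← Real.exp_add]
        congr 1; ring

end Tails

/-! ### Explicit constants and the exceptional noise events. -/

theorem cAlpha_nonneg (α : ℝ) : 0 ≤ cAlpha α := Real.sqrt_nonneg _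

theorem cAlpha_sq {α : ℝ} (hα : 0 < α) (hα1 : α ≤ 1) :
    cAlpha α ^ 2 = 2 * Real.log (16 / α) := by
  refine Real.sq_sqrt (mul_nonneg (by norm_num) (Real.log_nonneg ?_))
  rw [le_div_iff₀ hα]; linarith

theorem vAlpha_nonneg (m n : ℕ) {α : ℝ} (hα : 0 < α) (hα1 : α ≤ 1) : 0 ≤ vAlpha m n α := by
  have : 0 ≤ Real.log (55 * ((m : ℝ) + n + 1) / α) := by
    refine Real.log_nonneg ?_
    rw [le_div_iff₀ hα]
    have : (0 : ℝ) ≤ m := m.cast_nonneg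
    have : (0 : ℝ) ≤ n := n.cast_nonneg
    linarith
  unfold vAlpha
  positivity

theorem exp_neg_cAlpha_sq_div_two {α : ℝ} (hα : 0 < α) (hα1 : α ≤ 1) :
    Real.exp (-(cAlpha α ^ 2 / 2)) = α / 16 := by
  rw [cAlpha_sq hα hα1, mul_div_cancel_left₀ _ (two_ne_zero), Real.exp_neg,
    Real.exp_log (by positivity), inv_div]

theorem three_le_log_fiftyfive : 3 ≤ Real.log 55 := by
  rw [Real.le_log_iff_exp_le (by norm_num)]
  have h : Real.exp 3 = Real.exp 1 ^ 3 := by rw [← Real.exp_nat_mul]; norm_num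
  rw [h]
  calc Real.exp 1 ^ 3 ≤ 2.7182818286 ^ 3 := by
        gcongr
        exact Real.exp_one_lt_d9.le
    _ ≤ 55 := by norm_num

/-- With `N = m + n + 1` one has `N/(m+1) ≤ 1 + κ² ≤ (1 + 4κ)²`, and `log 55 ≥ 3` absorbs the
additive constants. Of the factor `2` in `V_α`, one half pays for the trace term and the other
leaves `log(55N/α)`. -/
theorem exp_sub_vAlpha_le (m n : ℕ) {α : ℝ} (hα : 0 < α) (hα1 : α ≤ 1) :
    Real.exp (2 + ((m + n + 1 : ℕ) : ℝ) / ((m : ℝ) + 1) * (1 + Real.log (m + n + 1 : ℕ))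
      - 4 * vAlpha m n α / 4) ≤ α / (55 * ((m : ℝ) + n + 1)) := by
  have hm : (0 : ℝ) ≤ m := m.cast_nonneg
  have hn : (0 : ℝ) ≤ n := n.cast_nonneg
  set N : ℝ := (m : ℝ) + n + 1 with hN
  have hN1 : 1 ≤ N := by linarith
  have hcast : ((m + n + 1 : ℕ) : ℝ) = N := by push_cast; rfl
  rw [hcast]
  set κ := kappa m n with hκ
  have hκ0 : 0 ≤ κ := Real.sqrt_nonneg _
  have hκ2 : κ ^ 2 = ((n : ℝ) + 1) / ((m : ℝ) + 1) := Real.sq_sqrt (by positivity)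
  have hratio : N / ((m : ℝ) + 1) ≤ 1 + κ ^ 2 := by
    rw [hκ2, div_le_iff₀ (by positivity), add_mul, div_mul_cancel₀ _ (by positivity)]
    linarith
  have hlogN : 0 ≤ Real.log N := Real.log_nonneg hN1
  set l := Real.log (55 * N) with hl
  have hl3 : 3 + Real.log N ≤ l := by
    rw [hl, Real.log_mul (by norm_num) (by linarith)]
    linarith [three_le_log_fiftyfive]
  set a := (1 + 4 * κ) ^ 2 with ha
  have ha1 : 1 + κ ^ 2 ≤ a := by rw [ha]; nlinarith
  have hlα : Real.log (55 * N / α) = l + Real.log (1 / α) := by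
    rw [hl, ← Real.log_mul (by positivity) (by positivity)]
    congr 1; ring
  have hα0 : 0 ≤ Real.log (1 / α) :=
    Real.log_nonneg (by rw [le_div_iff₀ hα]; linarith)
  have hmain : 2 + N / ((m : ℝ) + 1) * (1 + Real.log N) - 4 * vAlpha m n α / 4
      ≤ -Real.log (55 * N / α) := by
    have h1 : N / ((m : ℝ) + 1) * (1 + Real.log N) ≤ (1 + κ ^ 2) * (1 + Real.log N) := by gcongr
    have h2 : 2 + (1 + κ ^ 2) * (1 + Real.log N) ≤ (1 + κ ^ 2) * l := by nlinarith [sq_nonneg κ]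
    have h3 : (1 + κ ^ 2) * l ≤ a * l := by gcongr; linarith
    have hv : vAlpha m n α = 2 * a * (l + Real.log (1 / α)) := by
      rw [vAlpha, ← hN, hlα]
    rw [hv, hlα]
    nlinarith [sq_nonneg κ]
  calc _ ≤ Real.exp (-Real.log (55 * N / α)) := Real.exp_le_exp.2 hmain
    _ = _ := by rw [Real.exp_neg, Real.exp_log (by positivity), inv_div]

/-- The correlation is a bilinear form in the Fourier coefficients of two contractive images of the
same noise vector. The inequality `2ab ≤ a² + b²` separates it into two weighted chi-square sums, so
their dependence is harmless. -/
theorem norm_inner_fourierOutput_le {m n : ℕ} (K : Submodule ℂ (EuclideanSpace ℂ (Fin (n + 1))))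
    {t : ℝ} (k : Fin (m + 1)) (z : ℤ → ℂ)
    (h1 : ∑ j, ‖transfer m (m + n + 1) k j‖ *
      ‖inner ℂ (fourierVec (m + n + 1) j) (noiseVec m n z)‖ ^ 2 ≤ t)
    (h2 : ∑ j, ‖transfer m (m + n + 1) k j‖ *
      ‖inner ℂ (fourierVec (m + n + 1) j) (LinearMap.adjoint (lastCoords m n)
        (K.starProjection (lastCoords m n (noiseVec m n z))))‖ ^ 2 ≤ t) :
    ‖inner ℂ (K.starProjection (window n z)) (fourierOutput m n k z)‖ ≤ t := by
  rw [fourierOutput_eq, map_sum, inner_sum, ← lastCoords_noiseVec]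
  refine (norm_sum_le _ _).trans ?_
  set Z := noiseVec m n z
  have h3 : ∀ j, ‖inner ℂ (K.starProjection (lastCoords m n Z)) (lastCoords m n
      ((transfer m (m + n + 1) k j * inner ℂ (fourierVec (m + n + 1) j) Z) •
        fourierVec (m + n + 1) j))‖
      ≤ (‖transfer m (m + n + 1) k j‖ * ‖inner ℂ (fourierVec (m + n + 1) j) Z‖ ^ 2
        + ‖transfer m (m + n + 1) k j‖ * ‖inner ℂ (fourierVec (m + n + 1) j)
          (LinearMap.adjoint (lastCoords m n) (K.starProjection (lastCoords m n Z)))‖ ^ 2) / 2 := by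
    intro j
    rw [map_smul, inner_smul_right, norm_mul, norm_mul,
      norm_inner_symm (K.starProjection (lastCoords m n Z)),
      LinearMap.adjoint_inner_right, mul_assoc, ← mul_add, mul_div_assoc]
    gcongr
    linarith [two_mul_le_add_sq ‖inner ℂ (fourierVec (m + n + 1) j) Z‖
      ‖inner ℂ (lastCoords m n (fourierVec (m + n + 1) j))
        (K.starProjection (lastCoords m n Z))‖]
  refine (Finset.sum_le_sum fun j _ => h3 j).trans ?_
  rw [← Finset.sum_div, Finset.sum_add_distrib]
  linarith

theorem exists_event_norm_inner_fourierOutput_le (m n : ℕ)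
    (K : Submodule ℂ (EuclideanSpace ℂ (Fin (n + 1)))) {α : ℝ} (hα : 0 < α) (hα1 : α ≤ 1) :
    ∃ B : Set (EuclideanSpace ℂ (Fin (m + n + 1))), MeasurableSet B ∧
      (stdGaussian (EuclideanSpace ℂ (Fin (m + n + 1)))).real B ≤ 2 / 55 * α ∧
      ∀ z, noiseVec m n z ∉ B →
        ∀ k, ‖inner ℂ (K.starProjection (window n z)) (fourierOutput m n k z)‖
          ≤ √((m : ℝ) + 1) * (4 * vAlpha m n α) := by
  let T : EuclideanSpace ℂ (Fin (m + n + 1)) →ₗ[ℂ] EuclideanSpace ℂ (Fin (m + n + 1)) :=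
    LinearMap.adjoint (lastCoords m n) ∘ₗ K.starProjection.toLinearMap ∘ₗ lastCoords m n
  have hT : ∀ x, ‖T x‖ ≤ ‖x‖ := fun x => (norm_adjoint_apply_le (norm_lastCoords_le m n) _).trans
    ((Submodule.norm_starProjection_apply_le _ _).trans (norm_lastCoords_le m n x))
  have hM : (0 : ℝ) < √((m : ℝ) + 1) := Real.sqrt_pos.2 (by positivity)
  obtain ⟨B, hB⟩ : ∃ B : (EuclideanSpace ℂ (Fin (m + n + 1)) →ₗ[ℂ]
      EuclideanSpace ℂ (Fin (m + n + 1))) → Fin (m + 1) → Set (EuclideanSpace ℂ (Fin (m + n + 1))),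
      ∀ A k, B A k = {x | √((m : ℝ) + 1) * (4 * vAlpha m n α)
      < ∑ j, ‖transfer m (m + n + 1) k j‖ * ‖inner ℂ (fourierVec (m + n + 1) j) (A x)‖ ^ 2} :=
    ⟨_, fun _ _ => rfl⟩
  have hmeas : ∀ A k, MeasurableSet (B A k) := by
    intro A k
    rw [hB]
    have hA : Continuous A := A.continuous_of_finiteDimensional
    refine (isOpen_lt continuous_const ?_).measurableSet
    exact continuous_finsetSum _ fun τ _ =>
      continuous_const.mul ((continuous_const.inner hA).norm.pow 2)
  have hprob : ∀ A : EuclideanSpace ℂ (Fin (m + n + 1)) →ₗ[ℂ] EuclideanSpace ℂ (Fin (m + n + 1)),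
      (∀ x, ‖A x‖ ≤ ‖x‖) → ∀ k,
      (stdGaussian (EuclideanSpace ℂ (Fin (m + n + 1)))).real (B A k)
        ≤ α / (55 * ((m : ℝ) + n + 1)) := by
    intro A hA k
    rw [hB]
    exact (stdGaussian_weighted_sum_tail hA (orthonormal_fourierVec _) hM
      (fun j => norm_nonneg _) (norm_transfer_le m _ k)
      (sum_norm_transfer_le m _ (by omega) k) _).trans (exp_sub_vAlpha_le m n hα hα1)
  have hid : ∀ k, (stdGaussian (EuclideanSpace ℂ (Fin (m + n + 1)))).real (B LinearMap.id k)
      ≤ α / (55 * ((m : ℝ) + n + 1)) := hprob LinearMap.id fun x => le_of_eq rfl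
  have hunion : ∀ k, (stdGaussian (EuclideanSpace ℂ (Fin (m + n + 1)))).real
      (B LinearMap.id k ∪ B T k)
      ≤ α / (55 * ((m : ℝ) + n + 1)) + α / (55 * ((m : ℝ) + n + 1)) := by
    intro k
    have h1 := measureReal_union_le (μ := stdGaussian (EuclideanSpace ℂ (Fin (m + n + 1))))
      (B LinearMap.id k) (B T k)
    have h2 := hprob T hT k
    have h3 := hid k
    linarith
  refine ⟨⋃ k, (B LinearMap.id k ∪ B T k),
    MeasurableSet.iUnion fun k => (hmeas _ k).union (hmeas _ k), ?_, fun z hz k => ?_⟩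
  -- Union over `m + 1` frequencies and two events each; `(m + 1)/(m + n + 1) ≤ 1` removes the
  -- dimension.
  · refine (measureReal_iUnion_fintype_le _).trans ?_
    calc _ ≤ ∑ k : Fin (m + 1), (α / (55 * ((m : ℝ) + n + 1)) + α / (55 * ((m : ℝ) + n + 1))) :=
          Finset.sum_le_sum fun k _ => hunion k
      _ = (((m : ℝ) + 1) / ((m : ℝ) + n + 1)) * (2 / 55 * α) := by
          rw [Finset.sum_const, Finset.card_univ, Fintype.card_fin, nsmul_eq_mul]
          push_cast
          field_simp
          ring
      _ ≤ 2 / 55 * α := by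
          refine mul_le_of_le_one_left (by positivity) ?_
          rw [div_le_one (by positivity)]
          linarith [(n.cast_nonneg : (0 : ℝ) ≤ n)]
  · simp only [Set.mem_union, Set.mem_iUnion, not_or, not_exists] at hz
    obtain ⟨hz1, hz2⟩ := hz k
    rw [hB, Set.mem_ofPred_eq, not_lt] at hz1 hz2
    exact norm_inner_fourierOutput_le K k z hz1 hz2

theorem exists_noise_event (m n : ℕ) {s : ℕ} (hs : 1 ≤ s)
    (K : Submodule ℂ (EuclideanSpace ℂ (Fin (n + 1)))) (hK : Module.finrank ℂ K ≤ s)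
    (g : Fin (m + 1) → EuclideanSpace ℂ (Fin (n + 1))) {D : ℝ}
    (hg : ∑ τ, ‖g τ‖ ^ 2 ≤ ((m : ℝ) + 1) * D ^ 2) {α : ℝ} (hα : 0 < α) (hα1 : α ≤ 1) :
    ∃ G : Set (EuclideanSpace ℂ (Fin (m + n + 1))), MeasurableSet G ∧
      (stdGaussian (EuclideanSpace ℂ (Fin (m + n + 1)))).real Gᶜ ≤ α ∧
      ∀ z, noiseVec m n z ∈ G →
        ‖K.starProjection (window n z)‖ ≤ √(2 * s) + cAlpha α ∧
        ∑ τ, ‖inner ℂ (g τ) (Kᗮ.starProjection (window n z))‖ ^ 2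
          ≤ ((m : ℝ) + 1) * (4 * cAlpha α * D) ^ 2 ∧
        ∀ k, ‖inner ℂ (Kᗮ.starProjection (window n z)) (fourierOutput m n k z)‖
          ≤ √((m : ℝ) + 1) * (4 * vAlpha m n α) := by
  obtain ⟨B3, m3, p3, h3⟩ := exists_event_norm_inner_fourierOutput_le m n Kᗮ hα hα1
  let P : EuclideanSpace ℂ (Fin (m + n + 1)) →ₗ[ℂ] EuclideanSpace ℂ (Fin (n + 1)) :=
    Kᗮ.starProjection.toLinearMap ∘ₗ lastCoords m n
  have hR := norm_lastCoords_le m n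
  have hP : ∀ x, ‖P x‖ ≤ ‖x‖ := fun x =>
    (Submodule.norm_starProjection_apply_le _ _).trans (hR x)
  have hRc : Continuous (lastCoords m n) := LinearMap.continuous_of_finiteDimensional _
  have hPc : Continuous P := P.continuous_of_finiteDimensional
  let B1 := {x | √(2 * s) + cAlpha α < ‖K.starProjection (lastCoords m n x)‖}
  let B2 := {x | ((m : ℝ) + 1) * D ^ 2 * (16 * cAlpha α ^ 2) < ∑ τ, ‖inner ℂ (g τ) (P x)‖ ^ 2}
  have m1 : MeasurableSet B1 := by
    refine (isOpen_lt continuous_const ?_).measurableSet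
    exact (K.starProjection.continuous.comp hRc).norm
  have m2 : MeasurableSet B2 := by
    refine (isOpen_lt continuous_const ?_).measurableSet
    exact continuous_finsetSum _ fun τ _ => (continuous_const.inner hPc).norm.pow 2
  have p1 : (stdGaussian (EuclideanSpace ℂ (Fin (m + n + 1)))).real B1 ≤ α / 16 := by
    rw [← exp_neg_cAlpha_sq_div_two hα hα1]
    exact stdGaussian_norm_starProjection_tail hR K hs hK (cAlpha_nonneg α)
  have p2 : (stdGaussian (EuclideanSpace ℂ (Fin (m + n + 1)))).real B2 ≤ 2 * (α / 16) := by
    refine (stdGaussian_sum_inner_sq_tail hP g (by positivity) hg _).trans ?_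
    rw [← exp_neg_cAlpha_sq_div_two hα hα1]
    exact mul_le_mul_of_nonneg_left
      (Real.exp_le_exp.2 (by linarith [sq_nonneg (cAlpha α)])) (by norm_num)
  -- The total failure probability is at most `α/16 + 2α/16 + 2α/55 ≤ α`.
  refine ⟨(B1 ∪ B2 ∪ B3)ᶜ, ((m1.union m2).union m3).compl, ?_, fun z hz => ?_⟩
  · rw [compl_compl]
    have u1 := measureReal_union_le (μ := stdGaussian (EuclideanSpace ℂ (Fin (m + n + 1))))
      (B1 ∪ B2) B3
    have u2 := measureReal_union_le (μ := stdGaussian (EuclideanSpace ℂ (Fin (m + n + 1)))) B1 B2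
    linarith
  · simp only [Set.mem_compl_iff, Set.mem_union, not_or] at hz
    obtain ⟨⟨hz1, hz2⟩, hz3⟩ := hz
    rw [← lastCoords_noiseVec]
    refine ⟨not_lt.1 hz1, (not_lt.1 hz2).trans (le_of_eq (by ring)), ?_⟩
    rw [lastCoords_noiseVec]
    exact h3 z hz3

theorem hasLaw_noiseVec {Ω : Type*} [MeasurableSpace Ω] {P : Measure Ω} {ζ : ℤ → Ω → ℂ}
    (hζ : ∀ t, HasLaw (ζ t) stdComplexGaussian P) (hind : iIndepFun ζ P) (m n : ℕ) :
    HasLaw (fun ω => noiseVec m n fun t => ζ t ω)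
      (stdGaussian (EuclideanSpace ℂ (Fin (m + n + 1)))) P := by
  have hinj : Function.Injective fun i : Fin (m + n + 1) => ((i : ℕ) : ℤ) - m := by
    intro a b h
    simp only at h
    exact Fin.ext (by omega)
  exact hasLaw_stdGaussian_of_iIndepFun (fun i => hζ _) (hind.precomp hinj)

theorem measurable_noiseVec (m n : ℕ) : Measurable (noiseVec m n) :=
  (WithLp.measurable_toLp 2 _).comp (measurable_pi_lambda _ fun _ => measurable_pi_apply _)

/-! ### Comparison of the remainder terms -/

/-- The constant is `400 = 2 · 25 · 8`: `(1 + 4κ)² ≤ 25 max(1, κ²)`, and the logarithm in `V_α` is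
at most `7 log 2 + q ≤ 8q`, since `m + n ≥ 2` gives `q ≥ log 2`. The `log 2` inside the maximum is
what lets `√ℓ` dominate `c_α` when `α` is near one. -/
theorem le_r1 {m n : ℕ} (hm : 1 ≤ m) (hn : 1 ≤ n) {ϰ α : ℝ} (hϰ : 0 ≤ ϰ) (hα : 0 < α)
    (hα1 : α ≤ 1) : cAlpha α * ϰ + vAlpha m n α ≤ 400 * r1 m n ϰ α := by
  have hm' : (1 : ℝ) ≤ m := by exact_mod_cast hm
  have hn' : (1 : ℝ) ≤ n := by exact_mod_cast hn
  set κ := kappa m n with hκ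
  have hκ0 : 0 ≤ κ := Real.sqrt_nonneg _
  set M := max 1 (κ ^ 2) with hM
  set ℓ := max (Real.log (1 / α)) (Real.log 2) with hℓ
  have hlog2 : 0 < Real.log 2 := Real.log_pos (by norm_num)
  have hα0 : 0 ≤ Real.log (1 / α) := Real.log_nonneg (by rw [le_div_iff₀ hα]; linarith)
  have hℓ1 : Real.log (1 / α) ≤ ℓ := le_max_left _ _
  have hℓ2 : Real.log 2 ≤ ℓ := le_max_right _ _
  have hlog16 : Real.log 16 = 4 * Real.log 2 := by
    rw [show (16 : ℝ) = 2 ^ 4 by norm_num, Real.log_pow]; norm_num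
  have hc : cAlpha α ≤ 4 * √ℓ := by
    have h16 : Real.log (16 / α) = 4 * Real.log 2 + Real.log (1 / α) := by
      rw [← hlog16, ← Real.log_mul (by norm_num) (by positivity)]; congr 1; ring
    rw [show 4 * √ℓ = √(16 * ℓ) by
      rw [Real.sqrt_mul (by norm_num), show (16 : ℝ) = 4 ^ 2 by norm_num,
        Real.sqrt_sq (by norm_num)], cAlpha, h16]
    exact Real.sqrt_le_sqrt (by linarith)
  have hκM : (1 + 4 * κ) ^ 2 ≤ 25 * M := by
    have h1 : 1 ≤ M := le_max_left _ _
    have h2 : κ ^ 2 ≤ M := le_max_right _ _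
    nlinarith [sq_nonneg (κ - 1)]
  set q := Real.log (((m : ℝ) + n) / α) with hq
  have hq2 : Real.log 2 ≤ q := by
    refine Real.log_le_log (by norm_num) ?_
    rw [le_div_iff₀ hα]; linarith
  have hlog : Real.log (55 * ((m : ℝ) + n + 1) / α) ≤ 8 * q := by
    have h1 : Real.log (55 * ((m : ℝ) + n + 1) / α) ≤ Real.log (2 ^ 7 * (((m : ℝ) + n) / α)) := by
      refine Real.log_le_log (by positivity) ?_
      rw [← mul_div_assoc]
      gcongr ?_ / _
      linarith
    rw [Real.log_mul (by norm_num) (by positivity), Real.log_pow] at h1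
    push_cast at h1
    linarith
  have hv : vAlpha m n α ≤ 2 * (25 * M) * (8 * q) := by
    rw [vAlpha]
    have : 0 ≤ M := le_trans zero_le_one (le_max_left _ _)
    calc 2 * (1 + 4 * κ) ^ 2 * Real.log (55 * ((m : ℝ) + n + 1) / α)
        ≤ 2 * (1 + 4 * κ) ^ 2 * (8 * q) := by gcongr
      _ ≤ _ := by gcongr; linarith
  have hcϰ : cAlpha α * ϰ ≤ 4 * √ℓ * ϰ := by gcongr
  have hs : 0 ≤ ϰ * √ℓ := by positivity
  rw [r1]
  linarith

theorem le_sqrt_r2 {s : ℕ} (hs : 1 ≤ s) {ϱ ϰ α : ℝ} (hϱ : 1 ≤ ϱ) (hϰ : 0 ≤ ϰ) (hα : 0 < α)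
    (hα1 : α ≤ 1) : √(2 * (s : ℝ)) + cAlpha α ≤ 5 * √(r2 ϱ s ϰ α) := by
  have hs' : (1 : ℝ) ≤ s := by exact_mod_cast hs
  have hα0 : 0 ≤ Real.log (1 / α) := Real.log_nonneg (by rw [le_div_iff₀ hα]; linarith)
  have hr : Real.log (1 / α) + s ≤ r2 ϱ s ϰ α := by
    have : 0 ≤ ϰ * √(max (Real.log (1 / α)) (Real.log 2)) := by positivity
    rw [r2]
    nlinarith
  have h1 : √(2 * (s : ℝ)) ≤ 2 * √(r2 ϱ s ϰ α) := by
    rw [show 2 * √(r2 ϱ s ϰ α) = √(4 * r2 ϱ s ϰ α) by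
      rw [Real.sqrt_mul (by norm_num), show (4 : ℝ) = 2 ^ 2 by norm_num,
        Real.sqrt_sq (by norm_num)]]
    exact Real.sqrt_le_sqrt (by linarith)
  have h2 : cAlpha α ≤ 3 * √(r2 ϱ s ϰ α) := by
    have hlog16 : Real.log 16 = 4 * Real.log 2 := by
      rw [show (16 : ℝ) = 2 ^ 4 by norm_num, Real.log_pow]; norm_num
    have h16 : Real.log (16 / α) = 4 * Real.log 2 + Real.log (1 / α) := by
      rw [← hlog16, ← Real.log_mul (by norm_num) (by positivity)]; congr 1; ring
    rw [show 3 * √(r2 ϱ s ϰ α) = √(9 * r2 ϱ s ϰ α) by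
      rw [Real.sqrt_mul (by norm_num), show (9 : ℝ) = 3 ^ 2 by norm_num,
        Real.sqrt_sq (by norm_num)], cAlpha, h16]
    refine Real.sqrt_le_sqrt ?_
    linarith [Real.log_two_lt_d9]
  linarith

theorem one_le_r1 {m n : ℕ} (hm : 1 ≤ m) {ϰ α : ℝ} (hϰ : 0 ≤ ϰ) (hα : 0 < α)
    (hα1 : α ≤ 1) : 1 ≤ r1 m n ϰ α := by
  have hm' : (1 : ℝ) ≤ m := by exact_mod_cast hm
  have hq : 0 ≤ Real.log (((m : ℝ) + n) / α) := by
    refine Real.log_nonneg ?_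
    rw [le_div_iff₀ hα]
    linarith [(n.cast_nonneg : (0 : ℝ) ≤ n)]
  have h1 : 0 ≤ max 1 (kappa m n ^ 2) * Real.log (((m : ℝ) + n) / α) :=
    mul_nonneg (le_max_of_le_left zero_le_one) hq
  have h2 : 0 ≤ ϰ * √(max (Real.log (1 / α)) (Real.log 2)) := by positivity
  rw [r1]
  linarith

/-! ### From the noise event to the oracle inequality. -/

theorem oracle_bound_of_noise_event {m n s : ℕ} {σ ϰ lam ϱ α : ℝ} (hσ : 0 ≤ σ) (hϰ : 0 ≤ ϰ)
    (hlam : 0 < lam) (hα : 0 < α) (hα1 : α ≤ 1) (hs : 1 ≤ s)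
    {S : Submodule ℂ (ℤ → ℂ)} (hS : ∀ u ∈ S, shift u ∈ S) (hdim : Module.finrank ℂ S = s)
    {xS ε : ℤ → ℂ} (hxS : xS ∈ S)
    (hε : ∀ τ : ℕ, τ ≤ m → windowNorm n (shift^[τ] ε) ≤ ϰ * σ)
    {φ : ℤ → ℂ} (hφ : φ ∈ filters m) (hϱ : fourierL1 m φ ≤ ϱ / √((m : ℝ) + 1)) :
    ∃ G : Set (EuclideanSpace ℂ (Fin (m + n + 1))), MeasurableSet G ∧
      (stdGaussian (EuclideanSpace ℂ (Fin (m + n + 1)))).real Gᶜ ≤ α ∧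
      ∀ z, noiseVec m n z ∈ G → ∀ y : ℤ → ℂ, (∀ t, y t = (xS + ε) t + σ * z t) →
      ∀ φhat, IsPenalizedSolution m n lam σ y φhat →
        windowNorm n (xS + ε - conv φhat y) ≤ windowNorm n (xS + ε - conv φ y)
          + σ * (lam * ϱ + lam⁻¹ * (4 * (cAlpha α * ϰ + vAlpha m n α))
            + 2 * (√(2 * (s : ℝ)) + cAlpha α)) := by
  -- `finrank` is zero on infinite-dimensional spaces, so `s ≥ 1` forces finite dimension.
  have : Module.Finite ℂ S := Module.finite_of_finrank_pos (by omega)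
  have hK : Module.finrank ℂ (S.map (window n)) ≤ s := by
    rw [← hdim]; exact Submodule.finrank_map_le _ _
  have hg : ∑ τ : Fin (m + 1), ‖window n (shift^[(τ : ℕ)] ε)‖ ^ 2
      ≤ ((m : ℝ) + 1) * (ϰ * σ) ^ 2 := by
    calc _ ≤ ∑ τ : Fin (m + 1), (ϰ * σ) ^ 2 := by
          refine Finset.sum_le_sum fun τ _ => ?_
          rw [← windowNorm_eq]
          exact pow_le_pow_left₀ (Real.sqrt_nonneg _) (hε τ (by omega)) 2
      _ = _ := by simp
  -- The event depends on the subspace, on `ε` and on `α`, but on neither the filters nor `lam`;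
  -- hence it serves every minimizer at once.
  obtain ⟨G, hG, hGα, hGz⟩ := exists_noise_event m n hs (S.map (window n)) hK
    (fun τ => window n (shift^[(τ : ℕ)] ε)) hg hα hα1
  refine ⟨G, hG, hGα, fun z hz y hy φhat hφhat => ?_⟩
  obtain ⟨h1, h2, h3⟩ := hGz z hz
  have hc := cAlpha_nonneg α
  have hV := vAlpha_nonneg m n hα hα1
  have h := windowNorm_sub_conv_le_of_isPenalizedSolution (Bε := 4 * cAlpha α * ϰ)
    (Bz := 4 * vAlpha m n α) hσ hlam (by positivity) (by positivity) (by positivity) hS hxS h1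
    (h2.trans (le_of_eq (by ring))) h3 hy hφ hφhat
  have hr : √((m : ℝ) + 1) * fourierL1 m φ ≤ ϱ := by
    rwa [le_div_iff₀ (Real.sqrt_pos.2 (by positivity)), mul_comm] at hϱ
  have h4 : σ * (lam * (√((m : ℝ) + 1) * fourierL1 m φ)) ≤ σ * (lam * ϱ) := by gcongr
  linarith

end SignalRecovery

theorem theorem2 :
    ∃ C C' C'' : ℝ, 0 < C ∧ 0 < C' ∧ 0 < C'' ∧
      ∀ (Ω : Type*) [MeasurableSpace Ω] (P : Measure Ω) [IsProbabilityMeasure P]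
        (ζ : ℤ → Ω → ℂ),
        (∀ t, HasLaw (ζ t) SignalRecovery.stdComplexGaussian P) →
        iIndepFun ζ P →
      ∀ (m n s : ℕ), 1 ≤ m → 1 ≤ n →
      ∀ (σ ϰ lam ϱ : ℝ), 0 ≤ σ → 0 ≤ ϰ → 0 < lam → 1 ≤ ϱ →
      ∀ x : ℤ → ℂ, SignalRecovery.NearShiftInvariant m n s ϰ σ x →
      ∀ φ ∈ SignalRecovery.filters m,
        SignalRecovery.fourierL1 m φ ≤ ϱ / √((m : ℝ) + 1) →
      ∀ α : ℝ, 0 < α → α ≤ 1 →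
      ∃ Ξ : Set (ℤ → ℂ), MeasurableSet Ξ ∧
        ENNReal.ofReal (1 - α) ≤ P {ω | (fun t => ζ t ω) ∈ Ξ} ∧
        ∀ z ∈ Ξ, ∀ y : ℤ → ℂ, (∀ t, y t = x t + σ * z t) →
        ∀ φhat : ℤ → ℂ, SignalRecovery.IsPenalizedSolution m n lam σ y φhat →
          -- the oracle inequality with explicit constants
          (SignalRecovery.windowNorm n (x - SignalRecovery.conv φhat y) ≤
            SignalRecovery.windowNorm n (x - SignalRecovery.conv φ y)
              + σ * (lam * ϱ
                + 4 * lam⁻¹ * (SignalRecovery.cAlpha α * ϰ + SignalRecovery.vAlpha m n α))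
              + 2 * σ * (√(ϱ * SignalRecovery.wAlpha m n α)
                + √(SignalRecovery.cAlpha α * ϰ) + √(2 * (s : ℝ))
                + SignalRecovery.cAlpha α)) ∧
          -- the oracle inequality with absolute constants
          (SignalRecovery.windowNorm n (x - SignalRecovery.conv φhat y) ≤
            SignalRecovery.windowNorm n (x - SignalRecovery.conv φ y)
              + σ * (lam * ϱ + C * lam⁻¹ * SignalRecovery.r1 m n ϰ α
                + C' * √(SignalRecovery.r2 ϱ s ϰ α))) ∧
          -- the particular choice of the penalization parameter
          (lam = √(SignalRecovery.r1 m n ϰ α) →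
            SignalRecovery.windowNorm n (x - SignalRecovery.conv φhat y) ≤
              SignalRecovery.windowNorm n (x - SignalRecovery.conv φ y)
                + σ * (C'' * ϱ * √(SignalRecovery.r1 m n ϰ α)
                  + C' * √(SignalRecovery.r2 ϱ s ϰ α))) := by
  -- `1600 = 4 · 400` by `le_r1` and `10 = 2 · 5` by `le_sqrt_r2`; with `lam² = r₁` and `ϱ ≥ 1`,
  -- `lam ϱ + 1600 lam ≤ 1601 ϱ lam`.
  refine ⟨1600, 10, 1601, by norm_num, by norm_num, by norm_num, ?_⟩
  intro Ω _ P _ ζ hζ hind m n s hm hn σ ϰ lam ϱ hσ hϰ hlam hϱ x hx φ hφ hφϱ α hα hα1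
  obtain ⟨hs, -, S, hS, hdim, xS, hxS, ε, rfl, hε⟩ := hx
  obtain ⟨G, hG, hGα, hbound⟩ := SignalRecovery.oracle_bound_of_noise_event hσ hϰ hlam hα hα1 hs
    hS hdim hxS hε hφ hφϱ
  refine ⟨SignalRecovery.noiseVec m n ⁻¹' G, SignalRecovery.measurable_noiseVec m n hG, ?_, ?_⟩
  · have hlaw := SignalRecovery.hasLaw_noiseVec hζ hind m n
    have h1 : P {ω | (fun t => ζ t ω) ∈ SignalRecovery.noiseVec m n ⁻¹' G}
        = stdGaussian (EuclideanSpace ℂ (Fin (m + n + 1))) G := hlaw.measure_eq hG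
    rw [h1, ← ofReal_measureReal]
    refine ENNReal.ofReal_le_ofReal ?_
    rw [probReal_compl_eq_one_sub hG] at hGα
    linarith
  · intro z hz y hy φhat hφhat
    have h := hbound z hz y hy φhat hφhat
    have hc := SignalRecovery.cAlpha_nonneg α
    have hinv : 0 < lam⁻¹ := inv_pos.2 hlam
    have h1 := SignalRecovery.le_r1 hm hn hϰ hα hα1
    have h2 := SignalRecovery.le_sqrt_r2 hs hϱ hϰ hα hα1
    have h3 := SignalRecovery.one_le_r1 (n := n) hm hϰ hα hα1
    have hsecond : SignalRecovery.windowNorm n (xS + ε - SignalRecovery.conv φhat y) ≤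
        SignalRecovery.windowNorm n (xS + ε - SignalRecovery.conv φ y)
          + σ * (lam * ϱ + 1600 * lam⁻¹ * SignalRecovery.r1 m n ϰ α
            + 10 * √(SignalRecovery.r2 ϱ s ϰ α)) := by
      refine h.trans ?_
      gcongr _ + σ * ?_
      linarith [mul_le_mul_of_nonneg_left h1 hinv.le]
    refine ⟨?_, hsecond, fun hl => ?_⟩
    -- The two extra square roots in the explicit bound are nonnegative and are simply added.
    · refine h.trans ?_
      have e1 : 0 ≤ √(ϱ * SignalRecovery.wAlpha m n α) := Real.sqrt_nonneg _
      have e2 : 0 ≤ √(SignalRecovery.cAlpha α * ϰ) := Real.sqrt_nonneg _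
      nlinarith [mul_nonneg hσ e1, mul_nonneg hσ e2]
    · refine hsecond.trans ?_
      have hsq : lam * lam = SignalRecovery.r1 m n ϰ α := by
        rw [hl, Real.mul_self_sqrt (by linarith)]
      rw [← hl]
      gcongr _ + σ * (?_ + _)
      have : 1600 * lam⁻¹ * SignalRecovery.r1 m n ϰ α = 1600 * lam := by
        rw [← hsq]; field_simp
      rw [this]
      nlinarith
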